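/- Let $P$ be a finite set of $n$ points in the Euclidean plane, no three of them collinear. For an angle $\theta$ let $X_\theta,Y_\theta$ be the coordinate axes rotated counterclockwise by $\theta$; the (open, first) $\theta$-quadrant with apex $a$ is the set of points whose two coordinates in this rotated system are both strictly larger than those of $a$. A quadrant is $P$-free if it contains no point of $P$. The vertices of the staircase of $P$ at $\theta$ are the points of $P$ that are apexes of $P$-free $\theta$-quadrants; the staircase joins them in order from the rightmost to the topmost one, and between two consecutive vertices it turns at the apex of an extremal $\theta$-quadrant, i.e. a $P$-free $\theta$-quadrant each of whose two bounding rays passes through a point of $P$. Let $e_1,\dots,e_h$, $e_i=\overline{p_ip_{i+1}}$, be the edges of the convex hull of $P$ in counterclockwise order (if $n=2$, the segment counts as two edges, one in each direction). The subchain $A_i(P)$ is the set of all vertices of staircases and apexes of extremal quadrants that lie, for some $\theta$, on the part of the staircase of $P$ at $\theta$ from $p_i$ to $p_{i+1}$; the arc chain is the union of the subchains. Order $A_i(P)$ by orthogonal projection on $e_i$, from $p_i$ to $p_{i+1}$, and let $p_i=q_1,\dots,q_{n_i}=p_{i+1}$ be the points of $P$ on $A_i(P)$ in this order. The links of $A_i(P)$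 are the $n_i-1$ sets of all points of $A_i(P)$ whose projection lies between those of $q_j$ and $q_{j+1}$ (inclusive), $1\le j<n_i$. The link-disk of this link is the closed disk with diameter $\overline{q_jq_{j+1}}$, the edge-disk of $e_i$ is the closed disk with diameter $e_i$, and the radius of a link is the radius of its link-disk. Two sets intersect if they have a common point. Then: 1. There is an absolute constant $C$ such that, for every such $P$, at most $Cn$ unordered pairs of different links of the arc chain of $P$ intersect; that is, there are $O(n)$ pairs of intersecting links. Moreover, for every such $P$ and every link $L$ of $P$, with link-disk $D$ and radius $r$: 2. $D$ intersects at most $28$ edge-disks (counted by edges) of radius at least $r$; 3. for every hull edge $e_s$ whose edge-disk intersects $D$, at most $5$ links of $A_s(P)$ of radius at least $r$ intersect $D$; 4. at most $140$ links of $P$ other than $L$ that have radius at least $r$ intersect $L$. -/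

import Mathlib

noncomputable section

namespace ArcChain

/-- The Euclidean plane. -/
abbrev Plane := EuclideanSpace ℝ (Fin 2)

/-- No three pairwise different points of `P` lie on a line. -/
def NoThreeCollinear (P : Finset Plane) : Prop :=
  ∀ p ∈ P, ∀ q ∈ P, ∀ r ∈ P, p ≠ q → q ≠ r → p ≠ r → ¬ Collinear ℝ ({p, q, r} : Set Plane)

/-- Coordinate along the `x`-axis rotated counterclockwise by `θ`. -/
def xc (θ : ℝ) (a : Plane) : ℝ := a 0 * Real.cos θ + a 1 * Real.sin θ

/-- Coordinate along the `y`-axis rotated counterclockwise by `θ`. -/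
def yc (θ : ℝ) (a : Plane) : ℝ := -(a 0) * Real.sin θ + a 1 * Real.cos θ

/-- The first `θ`-quadrant with apex `a`; it is open (the rotated axes through `a` are removed). -/
def quadrant (θ : ℝ) (a : Plane) : Set Plane := {z | xc θ a < xc θ z ∧ yc θ a < yc θ z}

/-- The quadrant with apex `a` contains no element of `P`. -/
def IsFreeQuadrant (P : Finset Plane) (θ : ℝ) (a : Plane) : Prop :=
  ∀ p ∈ P, p ∉ quadrant θ a

/-- `p` is a vertex of the staircase of `P` at angle `θ`: a point of `P` that is the apex of a
`P`-free first `θ`-quadrant. -/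
def IsStaircaseVertex (P : Finset Plane) (θ : ℝ) (p : Plane) : Prop :=
  p ∈ P ∧ IsFreeQuadrant P θ p

/-- `a` is the apex of an extremal `θ`-quadrant: a `P`-free first `θ`-quadrant each of whose two
bounding rays is supported by a point of `P`. If `a ∉ P`, then `a` is a clockwise-turn vertex of
the staircase at `θ`. The rays are closed, so that the apexes of extremal quadrants together with
the staircase vertices (at which the traced arcs end) are exactly the points with this property. -/
def IsExtremalApex (P : Finset Plane) (θ : ℝ) (a : Plane) : Prop :=
  IsFreeQuadrant P θ a ∧
  (∃ u ∈ P, xc θ a ≤ xc θ u ∧ yc θ u = yc θ a) ∧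
  (∃ v ∈ P, xc θ v = xc θ a ∧ yc θ a ≤ yc θ v)

/-- `a` comes before `b` (or `a = b`) along the staircase at `θ`, which is directed from the
rightmost to the topmost vertex, in the rotated coordinate system. -/
def StaircaseLE (θ : ℝ) (a b : Plane) : Prop := xc θ b ≤ xc θ a ∧ yc θ a ≤ yc θ b

/-- An edge of the convex hull of `P`, directed counterclockwise: no point of `P` lies to the
right of the line from `src` to `tgt`. -/
@[ext] structure HullEdge (P : Finset Plane) where
  src : Plane
  tgt : Plane
  src_mem : src ∈ P
  tgt_mem : tgt ∈ P
  ne : src ≠ tgt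
  left : ∀ r ∈ P, 0 ≤ (tgt 0 - src 0) * (r 1 - src 1) - (tgt 1 - src 1) * (r 0 - src 0)

/-- The subchain of `P` corresponding to the hull edge `e`: the points traced, during a complete
rotation of the plane, by the apexes of the extremal quadrants belonging to a segment of a
staircase that connects the two endpoints of `e` (and the points of `P` on such a segment). -/
def subchain (P : Finset Plane) (e : HullEdge P) : Set Plane :=
  {a | ∃ θ : ℝ, IsStaircaseVertex P θ e.src ∧ IsStaircaseVertex P θ e.tgt ∧
    IsExtremalApex P θ a ∧ StaircaseLE θ e.src a ∧ StaircaseLE θ a e.tgt}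

/-- Position of the orthogonal projection of `a` on the line of `e`, increasing from `e.src` to
`e.tgt`. -/
def proj {P : Finset Plane} (e : HullEdge P) (a : Plane) : ℝ :=
  inner ℝ (a - e.src) (e.tgt - e.src)

/-- A link of `P`, given by a hull edge and two consecutive points of `P` on its subchain, in the
order of the projections on the edge. -/
@[ext] structure Link (P : Finset Plane) where
  edge : HullEdge P
  fst : Plane
  snd : Plane
  fst_mem : fst ∈ P
  snd_mem : snd ∈ P
  fst_mem_subchain : fst ∈ subchain P edge
  snd_mem_subchain : snd ∈ subchain P edge
  lt : proj edge fst < proj edge snd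
  consecutive : ∀ r ∈ P, r ∈ subchain P edge →
    ¬ (proj edge fst < proj edge r ∧ proj edge r < proj edge snd)

/-- The closed disk having the segment `pq` as a diameter. -/
def diameterDisk (p q : Plane) : Set Plane := Metric.closedBall (midpoint ℝ p q) (dist p q / 2)

variable {P : Finset Plane}

/-- The edge-disk of a hull edge. -/
def HullEdge.disk (e : HullEdge P) : Set Plane := diameterDisk e.src e.tgt

/-- The radius of the edge-disk. -/
def HullEdge.radius (e : HullEdge P) : ℝ := dist e.src e.tgt / 2

/-- The link as a set of points: the part of the subchain between its two endpoints. -/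
def Link.carrier (l : Link P) : Set Plane :=
  {a | a ∈ subchain P l.edge ∧ proj l.edge l.fst ≤ proj l.edge a ∧
    proj l.edge a ≤ proj l.edge l.snd}

/-- The link-disk of a link. -/
def Link.disk (l : Link P) : Set Plane := diameterDisk l.fst l.snd

/-- The radius of a link, that is, of its link-disk. -/
def Link.radius (l : Link P) : ℝ := dist l.fst l.snd / 2

/-- The unordered pairs of different links of the arc chain of `P` with a common point. -/
def intersectingPairs (P : Finset Plane) : Set (Sym2 (Link P)) :=
  {s | ∃ l m : Link P, l ≠ m ∧ (l.carrier ∩ m.carrier).Nonempty ∧ s = s(l, m)}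

end ArcChain

end

/-!
Let `e` be a hull edge and use the coordinates along and across `e`, with the point set above `e`.
A point of the subchain of `e` is the apex of an empty right-angled wedge that opens downwards
between the two endpoints of `e` (`IsWedge`, `mem_subchain_iff`). Emptiness of the wedge of a point
`b` of `P` implies that no other point of the subchain is in its wedge, so a point to the left and a
point to the right of `b`, unless both are above `b`, are seen from `b` at an angle of at least 90°
(`star_of_mem_subchain`): the subchain has no sharp peaks. The same comparison of angles shows that
the subchain lies in the edge-disk and each link in its link-disk
(`subchain_subset_disk`, `Link.carrier_subset_disk`).

*Edge-disks.* A point `x` lies in an edge-disk when it sees the edge at an angle of at least 90°.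
Turning from one endpoint to the other one, the line of sight then passes one of four fixed
perpendicular directions, and a ray leaves the convex hull through only one edge. So every point
lies in at most four edge-disks (`encard_disk_le_four`); points outside the hull or on its boundary
need separate, similar arguments. An edge-disk of radius at least `r` that meets a link-disk of
radius `r` contains a disk of radius `r` whose center is within `2 * r` of the center of the
link-disk. As a disk of radius `2 * r` is covered by seven disks of radius `r`, the edge-disk
contains one of seven fixed points, and there are at most `7 * 4 = 28` such edge-disks.

*Links of one subchain.* Suppose that six links of radius at least 1 of one subchain meet a disk of
radius 1. The four inner ones have chords of length at least 2 but total width at most 2, so each of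
them goes up or down, rather steeply. Going up and later down would form a sharp peak, so the inner
links first go down and then up. Three inner links going down would reach too far down to meet the
disk. If two go down and then two go up, the center of the disk is to the right of the first two or
to the left of the last two, and in both cases these two links and the outermost link next to
them cannot all meet the disk (`SixLinks.false`). So at most five links meet the disk.

*Pairs.* A link of radius at least `r` that meets a given link of radius `r` belongs to one of the
28 edges and is one of at most five links there, which gives 140. A link is determined by its edge
and its first point, and that point lies in the edge-disk, so there are at most `4 * n` links.
Counting each intersecting pair at its smaller link gives at most `560 * n` pairs.
-/

namespace ArcChain

/-! ### Six long links cannot meet a unit disk -/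

/-- A gap of width `g` and height gain `ρ` followed by a chord going down, of length at least `2`,
may be replaced by a single chord going down, of length at least `2`, provided that the peak between
them is not sharp. -/
lemma composite_down {g w h ρ : ℝ} (hg : 0 ≤ g) (hw : 0 < w) (hgw : g + w ≤ 2) (hh : 0 < h)
    (hlen : 4 ≤ w ^ 2 + h ^ 2) (hdot : ρ * h ≤ g * w) :
    0 ≤ h - ρ ∧ 4 ≤ (g + w) ^ 2 + (h - ρ) ^ 2 := by
  constructor
  · by_contra hc
    push Not at hc
    nlinarith [mul_pos hh (sub_pos.2 (sub_neg.1 hc)), mul_nonneg hg hw.le]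
  · nlinarith [sq_nonneg g, sq_nonneg ρ]

/-- A point of the disk whose diameter is a chord of width `w` going down exceeds the top end of the
chord by at most `w / 2`. -/
lemma le_of_mul_add_le {b h w : ℝ} (hw : 0 < w) (hh : 0 < h) (hb : b * (b + h) ≤ (w / 2) ^ 2) :
    b ≤ w / 2 := by
  by_contra hc
  push Not at hc
  nlinarith

/-- In front of a chord of length at least `2` going down, a gap of width `g` cannot gain much
height without forming a sharp peak. -/
lemma rise_le {g w h ρ : ℝ} (hg : 0 ≤ g) (hw : 0 < w) (hh : 0 < h) (hgw : g + w ≤ 2)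
    (hlen : 4 ≤ w ^ 2 + h ^ 2) (hdot : ρ * h ≤ g * w) : ρ ≤ g / 2 + w / 4 := by
  by_contra hc
  push Not at hc
  have t1 : (g / 2 + w / 4) * h < g * w := lt_of_lt_of_le (mul_lt_mul_of_pos_right hc hh) hdot
  have t2 : g * (g + 2 * w) ≤ h ^ 2 := by nlinarith
  have t3 : g * w / 2 ≤ (g / 2 + w / 4) ^ 2 := by nlinarith [sq_nonneg (g / 2 - w / 4)]
  have t4 : ((g / 2 + w / 4) * h) ^ 2 < (g * w) ^ 2 :=
    pow_lt_pow_left₀ t1 (by positivity) (by norm_num)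
  have t5 : (g * w / 2) * (g * (g + 2 * w)) ≤ (g / 2 + w / 4) ^ 2 * h ^ 2 :=
    mul_le_mul t3 t2 (by positivity) (by positivity)
  have t6 : 0 ≤ g ^ 3 * w := by positivity
  linarith [show ((g / 2 + w / 4) * h) ^ 2 = (g / 2 + w / 4) ^ 2 * h ^ 2 by ring,
    show (g * w / 2) * (g * (g + 2 * w)) = g ^ 3 * w / 2 + (g * w) ^ 2 by ring]

/-- The quantitative form of `SixLinks.not_two_down_left_of_center`. A chord of width `X` going down
by `Y` is followed by a gap of width `g` rising by `ρ` and a chord of width `t + z` going down by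
`h`; a point of the disk of the last chord has horizontal distances `t` and `z` from its ends and
exceeds its top end by `b`. The left-hand side bounds the vertical distance that two points of a
unit disk can have if their horizontal distances from the center are `X + g + (t + z)` and `z`. -/
lemma drop_gt {X Y g t z h ρ b : ℝ} (hX : 0 ≤ X) (hY : 0 ≤ Y) (hXY : 4 ≤ X ^ 2 + Y ^ 2)
    (hg : 0 ≤ g) (ht : 0 ≤ t) (hz : 0 ≤ z) (htz : 0 < t + z) (hh : 0 < h)
    (hT : X + g + (t + z) ≤ 1) (hlen : 4 ≤ (t + z) ^ 2 + h ^ 2) (hs : ρ * h ≤ g * (t + z))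
    (hd : b * (b + h) ≤ t * z) :
    2 - (X + g + (t + z)) ^ 2 / 2 - z ^ 2 / 2 < Y - ρ - b := by
  have hX2 : X ^ 2 ≤ 1 := pow_le_one₀ hX (by linarith)
  have hYb : 2 - X ^ 2 / 2 ≤ Y := by
    by_contra hc
    push Not at hc
    have h1 := pow_lt_pow_left₀ hc hY two_ne_zero
    have h2 := mul_nonneg (sq_nonneg X) (sub_nonneg.2 hX2)
    linarith [show (2 - X ^ 2 / 2) ^ 2
      = 4 - 7 / 4 * X ^ 2 - 1 / 4 * (X ^ 2 * (1 - X ^ 2)) by ring, sq_nonneg X]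
  have hh1 : 1 < h := by
    have h1 : (t + z) ^ 2 ≤ 1 := pow_le_one₀ htz.le (by linarith)
    by_contra hc
    push Not at hc
    have h2 : h ^ 2 ≤ 1 := pow_le_one₀ hh.le hc
    linarith
  have hr : ρ ≤ g * (t + z) := by
    by_contra hc
    push Not at hc
    have : 0 ≤ g * (t + z) := by positivity
    exact hs.not_gt (hc.trans (lt_mul_of_one_lt_right (this.trans_lt hc) hh1))
  have hbb : b ≤ t * z := by
    by_contra hc
    push Not at hc
    have : 0 ≤ t * z := by positivity
    have hb0 := this.trans_lt hc
    exact hd.not_gt (hc.trans (lt_mul_of_one_lt_right hb0 (by linarith)))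
  have e : 0 ≤ X * (g + (t + z)) := by positivity
  have e' : 0 < t ^ 2 + 2 * z ^ 2 := by
    rcases ht.lt_or_eq with h | h
    · positivity
    · have : 0 < z := by linarith
      positivity
  have e'' := sq_nonneg g
  linarith [show (X + g + (t + z)) ^ 2 = X ^ 2 + g ^ 2 + 2 * (X * (g + (t + z)))
    + 2 * (g * (t + z)) + (t ^ 2 + 2 * z ^ 2) + 2 * (t * z) - z ^ 2 by ring]

/-- Six links of a subchain that meet the unit disk with center `(cx, cy)`, in terms of coordinate
functions `x` and `y`. The set `S` is the subchain and `B` its points of the point set; the links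
have the end points `p i` and `q i`, are ordered from left to right, and `a i` is a common point of
the `i`-th link and the unit disk. The field `star` says that the subchain has no sharp peaks. -/
structure SixLinks {α : Type*} (x y : α → ℝ) (S B : Set α) (p q a : Fin 6 → α) (cx cy : ℝ) :
    Prop where
  sub : B ⊆ S
  p_mem : ∀ i, p i ∈ B
  q_mem : ∀ i, q i ∈ B
  a_mem : ∀ i, a i ∈ S
  lt : ∀ i, x (p i) < x (q i)
  le_of_lt : ∀ i j, i < j → x (q i) ≤ x (p j)
  p_le_a : ∀ i, x (p i) ≤ x (a i)
  a_le_q : ∀ i, x (a i) ≤ x (q i)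
  long : ∀ i, 4 ≤ (x (q i) - x (p i)) ^ 2 + (y (q i) - y (p i)) ^ 2
  disk : ∀ i, (y (a i) - y (p i)) * (y (a i) - y (q i)) ≤ (x (a i) - x (p i)) * (x (q i) - x (a i))
  star : ∀ z ∈ S, ∀ b ∈ B, ∀ z' ∈ S, x z ≤ x b → x b ≤ x z' → (y z ≤ y b ∨ y z' ≤ y b) →
    (y b - y z) * (y b - y z') ≤ (x b - x z) * (x z' - x b)
  center : ∀ i, (x (a i) - cx) ^ 2 + (y (a i) - cy) ^ 2 ≤ 1

namespace SixLinks

variable {α : Type*} {x y : α → ℝ} {S B : Set α} {p q a : Fin 6 → α} {cx cy : ℝ}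

/-- Reflection in a vertical line, which exchanges links going up with links going down. -/
lemma mirror (H : SixLinks x y S B p q a cx cy) :
    SixLinks (fun z => - x z) y S B (fun i => q i.rev) (fun i => p i.rev) (fun i => a i.rev)
      (-cx) cy where
  sub := H.sub
  p_mem i := H.q_mem _
  q_mem i := H.p_mem _
  a_mem i := H.a_mem _
  lt i := neg_lt_neg (H.lt _)
  le_of_lt i j hij := neg_le_neg (H.le_of_lt _ _ (Fin.rev_lt_rev.2 hij))
  p_le_a i := neg_le_neg (H.a_le_q _)
  a_le_q i := neg_le_neg (H.p_le_a _)
  long i := by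
    have := H.long i.rev
    linarith
  disk i := by
    have := H.disk i.rev
    linarith
  star z hz b hb z' hz' h1 h2 h3 := by
    have := H.star z' hz' b hb z hz (neg_le_neg_iff.1 h2) (neg_le_neg_iff.1 h1) h3.symm
    linarith
  center i := by
    have := H.center i.rev
    linarith

lemma x_bounds (H : SixLinks x y S B p q a cx cy) (i : Fin 6) :
    -1 ≤ x (a i) - cx ∧ x (a i) - cx ≤ 1 := by
  have h := H.center i
  have := sq_nonneg (y (a i) - cy)
  exact abs_le_of_sq_le_sq' (by linarith) zero_le_one

lemma y_bounds (H : SixLinks x y S B p q a cx cy) (i : Fin 6) :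
    -1 ≤ y (a i) - cy ∧ y (a i) - cy ≤ 1 := by
  have h := H.center i
  have := sq_nonneg (x (a i) - cx)
  exact abs_le_of_sq_le_sq' (by linarith) zero_le_one

lemma width (H : SixLinks x y S B p q a cx cy) : x (a 5) - x (a 0) ≤ 2 := by
  linarith [(H.x_bounds 0).1, (H.x_bounds 5).2]

/-- An inner link going up and a later one going down would form a sharp peak: the width available
to them is less than the length of their chords. -/
lemma not_up_down (H : SixLinks x y S B p q a cx cy) {i j : Fin 6} (h0 : 0 < i) (hij : i < j)
    (h5 : j < 5) (hu : y (p i) < y (q i)) (hd : y (q j) < y (p j)) : False := by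
  have hw := H.width
  have e1 := H.a_le_q 0
  have e2 := H.le_of_lt _ _ h0
  have e3 := H.le_of_lt _ _ hij
  have e4 := H.le_of_lt _ _ h5
  have e5 := H.p_le_a 5
  have li := H.lt i
  have lj := H.lt j
  have Li := H.long i
  have Lj := H.long j
  have s1 := H.star (p i) (H.sub (H.p_mem i)) (q i) (H.q_mem i) (q j) (H.sub (H.q_mem j))
    li.le (by linarith) (Or.inl hu.le)
  have s2 := H.star (p i) (H.sub (H.p_mem i)) (p j) (H.p_mem j) (q j) (H.sub (H.q_mem j))
    (by linarith) lj.le (Or.inr hd.le)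
  obtain ⟨w, hw'⟩ : ∃ w, w = x (q i) - x (p i) := ⟨_, rfl⟩
  obtain ⟨w', hw''⟩ : ∃ w, w = x (q j) - x (p j) := ⟨_, rfl⟩
  obtain ⟨u, hu'⟩ : ∃ w, w = y (q i) - y (p i) := ⟨_, rfl⟩
  obtain ⟨d, hd'⟩ : ∃ w, w = y (p j) - y (q j) := ⟨_, rfl⟩
  have hwpos : 0 < w := by linarith
  have hw'pos : 0 < w' := by linarith
  have hupos : 0 < u := by linarith
  have hdpos : 0 < d := by linarith
  have Hu : w * (2 - w) < u ^ 2 := by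
    rw [← hw'] at Li
    nlinarith
  have Hd : w' * (2 - w') < d ^ 2 := by
    rw [← hw''] at Lj
    nlinarith
  have t1 : u * (y (q i) - y (q j)) ≤ w * (2 - w) := by
    rw [hu', hw']
    refine s1.trans (mul_le_mul_of_nonneg_left ?_ ?_) <;> linarith
  have t2 : d * (y (p j) - y (p i)) ≤ w' * (2 - w') := by
    rw [hd', hw'']
    have : (x (p j) - x (p i)) * (x (q j) - x (p j)) ≤
      (2 - (x (q j) - x (p j))) * (x (q j) - x (p j)) :=
      mul_le_mul_of_nonneg_right (by linarith) (by linarith)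
    linarith
  have t3 : y (q i) - y (q j) < u := by
    by_contra hc
    push Not at hc
    nlinarith
  have t4 : y (p j) - y (p i) < d := by
    by_contra hc
    push Not at hc
    nlinarith
  linarith

/-- If the first inner link goes down, then the segment from the point of the disk on the outermost
link to the lower end of the inner link is like a chord of length at least `2` going down. -/
lemma first_drop (H : SixLinks x y S B p q a cx cy) (h1 : y (q 1) < y (p 1)) :
    0 ≤ y (a 0) - y (q 1) ∧
      4 ≤ (x (q 1) - x (a 0)) ^ 2 + (y (a 0) - y (q 1)) ^ 2 := by
  have hw := H.width
  have e1 := H.a_le_q 0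
  have e2 := H.le_of_lt 0 1 (by decide)
  have e4 := H.le_of_lt 1 5 (by decide)
  have e5 := H.p_le_a 5
  have li := H.lt 1
  have s := H.star (a 0) (H.a_mem 0) (p 1) (H.p_mem 1) (q 1) (H.sub (H.q_mem 1)) (by linarith)
    li.le (Or.inr h1.le)
  have := composite_down (g := x (p 1) - x (a 0)) (w := x (q 1) - x (p 1))
    (h := y (p 1) - y (q 1)) (ρ := y (p 1) - y (a 0)) (by linarith) (by linarith) (by linarith)
    (by linarith) (by linarith [H.long 1]) s
  refine ⟨by linarith [this.1], ?_⟩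
  nlinarith [this.2]

lemma not_three_down (H : SixLinks x y S B p q a cx cy) (h1 : y (q 1) < y (p 1))
    (h2 : y (q 2) < y (p 2)) (h3 : y (q 3) < y (p 3)) : False := by
  obtain ⟨f1, f2⟩ := H.first_drop h1
  have hw := H.width
  have e1 := H.a_le_q 0
  have e2 := H.le_of_lt 0 1 (by decide)
  have e3 := H.le_of_lt 1 2 (by decide)
  have e4 := H.le_of_lt 2 3 (by decide)
  have e5 := H.le_of_lt 3 5 (by decide)
  have e6 := H.p_le_a 5
  have l1 := H.lt 1
  have l2 := H.lt 2
  have l3 := H.lt 3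
  have s2 := H.star (q 1) (H.sub (H.q_mem 1)) (p 2) (H.p_mem 2) (q 2) (H.sub (H.q_mem 2))
    (by linarith) l2.le (Or.inr h2.le)
  have s3 := H.star (q 2) (H.sub (H.q_mem 2)) (p 3) (H.p_mem 3) (q 3) (H.sub (H.q_mem 3))
    (by linarith) l3.le (Or.inr h3.le)
  obtain ⟨g1, g2⟩ := composite_down (g := x (p 2) - x (q 1)) (w := x (q 2) - x (p 2))
    (h := y (p 2) - y (q 2)) (ρ := y (p 2) - y (q 1)) (by linarith) (by linarith) (by linarith)
    (by linarith) (by linarith [H.long 2]) s2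
  -- a chord of length `2` and width `X` has height at least `2 - X`
  have key : ∀ X Y : ℝ, 0 ≤ Y → 0 ≤ X → 4 ≤ X ^ 2 + Y ^ 2 → 2 - X ≤ Y := by
    intro X Y hY hX h
    by_contra hc
    push Not at hc
    nlinarith
  have k1 := key _ _ f1 (by linarith) f2
  have k2 := key _ _ g1 (by linarith) g2
  have hy : y (a 0) - y (a 3) ≤ 2 := by linarith [(H.y_bounds 0).2, (H.y_bounds 3).1]
  have L3 := H.long 3
  have d3 := H.disk 3
  obtain ⟨g, hg⟩ : ∃ g, g = x (p 3) - x (q 2) := ⟨_, rfl⟩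
  obtain ⟨w, hw'⟩ : ∃ g, g = x (q 3) - x (p 3) := ⟨_, rfl⟩
  obtain ⟨h, hh⟩ : ∃ g, g = y (p 3) - y (q 3) := ⟨_, rfl⟩
  obtain ⟨ρ, hρ⟩ : ∃ g, g = y (p 3) - y (q 2) := ⟨_, rfl⟩
  obtain ⟨b, hb⟩ : ∃ g, g = y (a 3) - y (p 3) := ⟨_, rfl⟩
  have hg0 : 0 ≤ g := by linarith
  have hw0 : 0 < w := by linarith
  have hh0 : 0 < h := by linarith
  have hgw : g + w ≤ 2 := by linarith
  have hs : ρ * h ≤ g * w := by rw [hρ, hh, hg, hw']; exact s3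
  have hl : 4 ≤ w ^ 2 + h ^ 2 := by
    rw [hw', hh, ← neg_sq (y (p 3) - y (q 3)), neg_sub]
    exact L3
  have hb2 : b ≤ w / 2 := by
    have : b * (b + h) ≤ (w / 2) ^ 2 := by
      rw [show b + h = y (a 3) - y (q 3) by linarith, hb, hw']
      refine d3.trans ?_
      linarith [sq_nonneg (x (a 3) - (x (p 3) + x (q 3)) / 2),
        show ((x (q 3) - x (p 3)) / 2) ^ 2 = (x (a 3) - x (p 3)) * (x (q 3) - x (a 3))
          + (x (a 3) - (x (p 3) + x (q 3)) / 2) ^ 2 by ring]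
    exact le_of_mul_add_le hw0 hh0 this
  have hr := rise_le hg0 hw0 hh0 hgw hl hs
  linarith

lemma not_two_down_left_of_center (H : SixLinks x y S B p q a cx cy) (h1 : y (q 1) < y (p 1))
    (h2 : y (q 2) < y (p 2)) (hc : x (q 2) ≤ cx) : False := by
  obtain ⟨f1, f2⟩ := H.first_drop h1
  have hw := H.width
  have e1 := H.a_le_q 0
  have e2 := H.le_of_lt 0 1 (by decide)
  have e3 := H.le_of_lt 1 2 (by decide)
  have l1 := H.lt 1
  have l2 := H.lt 2
  have e4 := H.a_le_q 2
  have e5 := H.p_le_a 2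
  have s2 := H.star (q 1) (H.sub (H.q_mem 1)) (p 2) (H.p_mem 2) (q 2) (H.sub (H.q_mem 2))
    (by linarith) l2.le (Or.inr h2.le)
  have L2 := H.long 2
  have d2 := H.disk 2
  have c0 := H.center 0
  have c2 := H.center 2
  -- the upper and lower half of the unit circle lie between two parabolas
  have key : ∀ T Z : ℝ, T ^ 2 + Z ^ 2 ≤ 1 → Z ≤ 1 - T ^ 2 / 2 := by
    intro T Z h
    nlinarith [sq_nonneg (Z - 1)]
  have k0 := key _ _ c0
  have k2 := key (x (a 2) - cx) (cy - y (a 2)) (by nlinarith)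
  obtain ⟨X, hX⟩ : ∃ g, g = x (q 1) - x (a 0) := ⟨_, rfl⟩
  obtain ⟨Y, hY⟩ : ∃ g, g = y (a 0) - y (q 1) := ⟨_, rfl⟩
  obtain ⟨g, hg⟩ : ∃ g, g = x (p 2) - x (q 1) := ⟨_, rfl⟩
  obtain ⟨t, ht⟩ : ∃ g, g = x (a 2) - x (p 2) := ⟨_, rfl⟩
  obtain ⟨z, hz⟩ : ∃ g, g = x (q 2) - x (a 2) := ⟨_, rfl⟩
  obtain ⟨h, hh⟩ : ∃ g, g = y (p 2) - y (q 2) := ⟨_, rfl⟩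
  obtain ⟨ρ, hρ⟩ : ∃ g, g = y (p 2) - y (q 1) := ⟨_, rfl⟩
  obtain ⟨b, hb⟩ : ∃ g, g = y (a 2) - y (p 2) := ⟨_, rfl⟩
  rw [← hX, ← hY] at f2
  rw [← hY] at f1
  have hX0 : 0 ≤ X := by linarith
  have hg0 : 0 ≤ g := by linarith
  have ht0 : 0 ≤ t := by linarith
  have hz0 : 0 ≤ z := by linarith
  have htz : 0 < t + z := by linarith
  have hh0 : 0 < h := by linarith
  have hT : X + g + (t + z) ≤ cx - x (a 0) := by linarith
  have hT1 : X + g + (t + z) ≤ 1 := by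
    linarith [(H.x_bounds 0).1]
  have hTs : (X + g + (t + z)) ^ 2 ≤ (x (a 0) - cx) ^ 2 := by
    rw [← neg_sq (x (a 0) - cx)]
    exact pow_le_pow_left₀ (by positivity) (by linarith) 2
  have hzs : z ^ 2 ≤ (x (a 2) - cx) ^ 2 := by
    rw [← neg_sq (x (a 2) - cx)]
    exact pow_le_pow_left₀ (by positivity) (by linarith) 2
  have hlen : 4 ≤ (t + z) ^ 2 + h ^ 2 := by
    rw [show t + z = x (q 2) - x (p 2) by linarith, hh,
      ← neg_sq (y (p 2) - y (q 2)), neg_sub]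
    exact L2
  have hs : ρ * h ≤ g * (t + z) := by
    rw [show t + z = x (q 2) - x (p 2) by linarith, hρ, hh, hg]
    exact s2
  have hd : b * (b + h) ≤ t * z := by
    rw [show b + h = y (a 2) - y (q 2) by linarith, hb, ht, hz]
    exact d2
  have hfin := drop_gt hX0 f1 f2 hg0 ht0 hz0 htz hh0 hT1 hlen hs hd
  linarith

theorem false (H : SixLinks x y S B p q a cx cy) : False := by
  have M := H.mirror
  have ne : ∀ i : Fin 6, 0 < i → i < 5 → y (p i) < y (q i) ∨ y (q i) < y (p i) := by
    intro i h0 h5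
    rcases lt_trichotomy (y (p i)) (y (q i)) with h | h | h
    · exact Or.inl h
    · exfalso
      have L := H.long i
      rw [h, sub_self] at L
      have hw := H.width
      have e1 := H.a_le_q 0
      have e2 := H.le_of_lt _ _ h0
      have e4 := H.le_of_lt _ _ h5
      have e5 := H.p_le_a 5
      have li := H.lt i
      -- another link of the range takes up a positive part of the width
      obtain ⟨j, hj0, hj5, hij⟩ : ∃ j : Fin 6, 0 < j ∧ j < 5 ∧ (i < j ∨ j < i) := by
        have : ∀ i : Fin 6, ∃ j : Fin 6, 0 < j ∧ j < 5 ∧ (i < j ∨ j < i) := by decide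
        exact this i
      have f2 := H.le_of_lt _ _ hj0
      have f4 := H.le_of_lt _ _ hj5
      have lj := H.lt j
      rcases hij with hij | hij
      · have := H.le_of_lt _ _ hij
        nlinarith
      · have := H.le_of_lt _ _ hij
        nlinarith
    · exact Or.inr h
  rcases ne 2 (by decide) (by decide) with h2 | h2
  · have h3 := (ne 3 (by decide) (by decide)).resolve_right
      (H.not_up_down (i := 2) (by decide) (by decide) (by decide) h2)
    have h4 := (ne 4 (by decide) (by decide)).resolve_right
      (H.not_up_down (i := 2) (by decide) (by decide) (by decide) h2)
    exact M.not_three_down h4 h3 h2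
  · have h1 := (ne 1 (by decide) (by decide)).resolve_left
      fun h => H.not_up_down (j := 2) (by decide) (by decide) (by decide) h h2
    rcases ne 3 (by decide) (by decide) with h3 | h3
    · have h4 := (ne 4 (by decide) (by decide)).resolve_right
        (H.not_up_down (i := 3) (by decide) (by decide) (by decide) h3)
      rcases le_total (x (q 2)) cx with hc | hc
      · exact H.not_two_down_left_of_center h1 h2 hc
      · exact M.not_two_down_left_of_center h4 h3
          (neg_le_neg (hc.trans (H.le_of_lt 2 3 (by decide))))
    · exact H.not_three_down h1 h2 h3

end SixLinks

variable {P : Finset Plane}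

/-! ### Coordinates of the plane -/

lemma dist_sq_eq (p q : Plane) : dist p q ^ 2 = (p 0 - q 0) ^ 2 + (p 1 - q 1) ^ 2 := by
  rw [EuclideanSpace.dist_eq, Real.sq_sqrt (by positivity), Fin.sum_univ_two, Real.dist_eq,
    Real.dist_eq, sq_abs, sq_abs]

lemma plane_ext {p q : Plane} (h0 : p 0 = q 0) (h1 : p 1 = q 1) : p = q := by
  ext i
  fin_cases i
  · exact h0
  · exact h1

lemma mem_diameterDisk {p q a : Plane} : a ∈ diameterDisk p q ↔
    (p 0 - a 0) * (q 0 - a 0) + (p 1 - a 1) * (q 1 - a 1) ≤ 0 := by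
  have hm : ∀ i, midpoint ℝ p q i = (p i + q i) / 2 := by
    intro i
    simp [midpoint_eq_smul_add]
    ring
  rw [diameterDisk, Metric.mem_closedBall, ← sq_le_sq₀ dist_nonneg (by positivity), div_pow,
    dist_sq_eq, dist_sq_eq, hm, hm]
  constructor <;> intro h <;> nlinarith

lemma collinear_of_det_eq_zero {p q r : Plane}
    (h : (q 0 - p 0) * (r 1 - p 1) - (q 1 - p 1) * (r 0 - p 0) = 0) (hpq : p ≠ q) :
    Collinear ℝ ({p, q, r} : Set Plane) := by
  rw [collinear_iff_of_mem (p₀ := p) (by simp)]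
  have hL : (q 0 - p 0) ^ 2 + (q 1 - p 1) ^ 2 ≠ 0 := by
    intro h0
    have h1 : q 0 - p 0 = 0 := by nlinarith [sq_nonneg (q 0 - p 0), sq_nonneg (q 1 - p 1)]
    have h2 : q 1 - p 1 = 0 := by nlinarith [sq_nonneg (q 0 - p 0), sq_nonneg (q 1 - p 1)]
    exact hpq (plane_ext (by linarith) (by linarith))
  refine ⟨q - p, ?_⟩
  intro z hz
  simp only [Set.mem_insert_iff, Set.mem_singleton_iff] at hz
  rcases hz with rfl | rfl | rfl
  · exact ⟨0, by simp⟩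
  · exact ⟨1, by simp⟩
  · refine ⟨((z 0 - p 0) * (q 0 - p 0) + (z 1 - p 1) * (q 1 - p 1)) /
      ((q 0 - p 0) ^ 2 + (q 1 - p 1) ^ 2), plane_ext ?_ ?_⟩
    · simp only [vadd_eq_add, PiLp.add_apply, PiLp.smul_apply, PiLp.sub_apply, smul_eq_mul]
      field_simp
      linear_combination (-(q 1 - p 1)) * h
    · simp only [vadd_eq_add, PiLp.add_apply, PiLp.smul_apply, PiLp.sub_apply, smul_eq_mul]
      field_simp
      linear_combination (q 0 - p 0) * h

lemma NoThreeCollinear.eq_or_eq (hP : NoThreeCollinear P) {p q r : Plane} (hp : p ∈ P) (hq : q ∈ P)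
    (hr : r ∈ P) (hpq : p ≠ q)
    (h : (q 0 - p 0) * (r 1 - p 1) - (q 1 - p 1) * (r 0 - p 0) = 0) : r = p ∨ r = q := by
  by_contra hc
  push Not at hc
  exact hP p hp q hq r hr hpq hc.2.symm hc.1.symm (collinear_of_det_eq_zero h hpq)

/-- The signed distance of `a` to the line of `e`, scaled by the length of `e` and positive to the
left of `e`. Together with `proj e` it forms an orthogonal coordinate system. -/
def height (e : HullEdge P) (a : Plane) : ℝ :=
  (e.tgt 0 - e.src 0) * (a 1 - e.src 1) - (e.tgt 1 - e.src 1) * (a 0 - e.src 0)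

/-- The square of the length of a hull edge. -/
def HullEdge.lenSq (e : HullEdge P) : ℝ := (e.tgt 0 - e.src 0) ^ 2 + (e.tgt 1 - e.src 1) ^ 2

lemma proj_eq (e : HullEdge P) (a : Plane) :
    proj e a = (a 0 - e.src 0) * (e.tgt 0 - e.src 0) + (a 1 - e.src 1) * (e.tgt 1 - e.src 1) := by
  simp [proj, PiLp.inner_apply, Fin.sum_univ_two]
  ring

lemma HullEdge.lenSq_pos (e : HullEdge P) : 0 < e.lenSq := by
  have : 0 < dist e.src e.tgt ^ 2 := pow_pos (dist_pos.2 e.ne) 2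
  rw [dist_sq_eq] at this
  unfold HullEdge.lenSq
  linarith

lemma proj_src (e : HullEdge P) : proj e e.src = 0 := by simp [proj_eq]
lemma height_src (e : HullEdge P) : height e e.src = 0 := by simp [height]
lemma proj_tgt (e : HullEdge P) : proj e e.tgt = e.lenSq := by rw [proj_eq, HullEdge.lenSq]; ring
lemma height_tgt (e : HullEdge P) : height e e.tgt = 0 := by rw [height]; ring

lemma height_nonneg (e : HullEdge P) {p : Plane} (hp : p ∈ P) : 0 ≤ height e p := e.left p hp

lemma lenSq_mul_dot (e : HullEdge P) (p q r s : Plane) :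
    e.lenSq * ((p 0 - q 0) * (r 0 - s 0) + (p 1 - q 1) * (r 1 - s 1)) =
      (proj e p - proj e q) * (proj e r - proj e s)
        + (height e p - height e q) * (height e r - height e s) := by
  simp only [proj_eq, height, HullEdge.lenSq]
  ring

lemma eq_of_proj_eq_of_height_eq (e : HullEdge P) {p q : Plane} (h : proj e p = proj e q)
    (h' : height e p = height e q) : p = q := by
  have := lenSq_mul_dot e p q p q
  rw [h, h', sub_self, sub_self] at this
  have h0 : dist p q ^ 2 = 0 := by
    rw [dist_sq_eq]
    have := e.lenSq_pos
    nlinarith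
  exact dist_eq_zero.1 (pow_eq_zero_iff (two_ne_zero) |>.1 h0)

lemma NoThreeCollinear.eq_src_or_eq_tgt (hP : NoThreeCollinear P) (e : HullEdge P) {p : Plane}
    (hp : p ∈ P) (h : height e p = 0) : p = e.src ∨ p = e.tgt :=
  hP.eq_or_eq e.src_mem e.tgt_mem hp e.ne h

/-! ### Empty wedges -/

/-- In the coordinates `proj e`, `height e`, the point `a` is the apex of an extremal quadrant
whose bounding rays point in the directions `(-c, -s)` and `(s, -c)` and between which both
endpoints of `e` lie on the correct sides. -/
structure IsWedge (e : HullEdge P) (c s : ℝ) (a : Plane) : Prop where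
  c_nonneg : 0 ≤ c
  s_nonneg : 0 ≤ s
  norm : c ^ 2 + s ^ 2 = e.lenSq
  free : ∀ p ∈ P, ¬ (0 < -c * (proj e p - proj e a) - s * (height e p - height e a) ∧
    0 < s * (proj e p - proj e a) - c * (height e p - height e a))
  left : ∃ u ∈ P, 0 ≤ -c * (proj e u - proj e a) - s * (height e u - height e a) ∧
    s * (proj e u - proj e a) = c * (height e u - height e a)
  right : ∃ v ∈ P, 0 ≤ s * (proj e v - proj e a) - c * (height e v - height e a) ∧
    -c * (proj e v - proj e a) = s * (height e v - height e a)
  src_x : 0 ≤ c * proj e a + s * height e a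
  src_y : c * height e a ≤ s * proj e a
  tgt_x : s * height e a ≤ c * (e.lenSq - proj e a)
  tgt_y : 0 ≤ s * (e.lenSq - proj e a) + c * height e a

lemma lenSq_mul_xc (e : HullEdge P) (θ : ℝ) (p q : Plane) :
    e.lenSq * (xc θ p - xc θ q) = -(xc θ e.src - xc θ e.tgt) * (proj e p - proj e q)
      - (yc θ e.tgt - yc θ e.src) * (height e p - height e q) := by
  simp only [xc, yc, proj_eq, height, HullEdge.lenSq]
  ring

lemma lenSq_mul_yc (e : HullEdge P) (θ : ℝ) (p q : Plane) :
    e.lenSq * (yc θ p - yc θ q) = (yc θ e.tgt - yc θ e.src) * (proj e p - proj e q)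
      - (xc θ e.src - xc θ e.tgt) * (height e p - height e q) := by
  simp only [xc, yc, proj_eq, height, HullEdge.lenSq]
  ring

lemma mem_subchain_iff {e : HullEdge P} {a : Plane} : a ∈ subchain P e ↔
    ∃ θ, IsWedge e (xc θ e.src - xc θ e.tgt) (yc θ e.tgt - yc θ e.src) a := by
  have hL := e.lenSq_pos
  have hx : ∀ θ p q, xc θ p < xc θ q ↔ 0 < -(xc θ e.src - xc θ e.tgt) * (proj e q - proj e p)
      - (yc θ e.tgt - yc θ e.src) * (height e q - height e p) := by
    intro θ p q
    rw [← lenSq_mul_xc, mul_pos_iff_of_pos_left hL, sub_pos]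
  have hy : ∀ θ p q, yc θ p < yc θ q ↔ 0 < (yc θ e.tgt - yc θ e.src) * (proj e q - proj e p)
      - (xc θ e.src - xc θ e.tgt) * (height e q - height e p) := by
    intro θ p q
    rw [← lenSq_mul_yc, mul_pos_iff_of_pos_left hL, sub_pos]
  constructor
  · rintro ⟨θ, -, -, ⟨hfree, ⟨u, hu, hu1, hu2⟩, ⟨v, hv, hv1, hv2⟩⟩, ⟨h1, h2⟩, ⟨h3, h4⟩⟩
    refine ⟨θ, by linarith, by linarith, ?_, ?_, ⟨u, hu, ?_, ?_⟩, ⟨v, hv, ?_, ?_⟩, ?_, ?_, ?_, ?_⟩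
    · have := Real.sin_sq_add_cos_sq θ
      simp only [xc, yc, HullEdge.lenSq]
      linear_combination ((e.tgt 0 - e.src 0) ^ 2 + (e.tgt 1 - e.src 1) ^ 2) * this
    · intro p hp h
      exact hfree p hp ⟨(hx θ a p).2 h.1, (hy θ a p).2 h.2⟩
    · rw [← lenSq_mul_xc]; exact mul_nonneg hL.le (by linarith)
    · have := lenSq_mul_yc e θ u a
      rw [hu2, sub_self, mul_zero] at this
      linarith
    · rw [← lenSq_mul_yc]; exact mul_nonneg hL.le (by linarith)
    · have := lenSq_mul_xc e θ v a
      rw [hv1, sub_self, mul_zero] at this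
      linarith
    · have := lenSq_mul_xc e θ e.src a
      rw [proj_src, height_src] at this
      have := mul_nonneg hL.le (sub_nonneg.2 h1)
      linarith
    · have := lenSq_mul_yc e θ e.src a
      rw [proj_src, height_src] at this
      have := mul_nonneg hL.le (sub_nonneg.2 h2)
      linarith
    · have := lenSq_mul_xc e θ e.tgt a
      rw [proj_tgt, height_tgt] at this
      have := mul_nonneg hL.le (sub_nonneg.2 h3)
      linarith
    · have := lenSq_mul_yc e θ e.tgt a
      rw [proj_tgt, height_tgt] at this
      have := mul_nonneg hL.le (sub_nonneg.2 h4)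
      linarith
  · rintro ⟨θ, W⟩
    -- on the line of `e` the quadrant opens to the side without points of `P`
    have key : ∀ q, height e q = 0 → IsFreeQuadrant P θ q := by
      intro q hq p hp ⟨h1, h2⟩
      rw [hx] at h1
      rw [hy] at h2
      have h3 := height_nonneg e hp
      have h4 := W.c_nonneg
      have h5 := W.s_nonneg
      have h6 := W.norm
      rw [hq, sub_zero] at h1 h2
      set c := xc θ e.src - xc θ e.tgt
      set s := yc θ e.tgt - yc θ e.src
      have t1 := mul_nonneg h5 h1.le
      have t2 := mul_nonneg h4 h2.le
      have t3 : 0 ≤ e.lenSq * height e p := mul_nonneg hL.le h3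
      rw [← h6] at t3
      have t4 : s * (-c * (proj e p - proj e q) - s * height e p) = 0 := by nlinarith
      have t5 : c * (s * (proj e p - proj e q) - c * height e p) = 0 := by nlinarith
      rcases mul_eq_zero.1 t4 with h | h
      · rcases mul_eq_zero.1 t5 with h' | h'
        · rw [h, h'] at h6
          linarith
        · linarith
      · linarith
    have nx : ∀ p q, 0 ≤ -(xc θ e.src - xc θ e.tgt) * (proj e p - proj e q)
      - (yc θ e.tgt - yc θ e.src) * (height e p - height e q) → xc θ q ≤ xc θ p := by
      intro p q h
      rw [← lenSq_mul_xc] at h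
      exact sub_nonneg.1 (nonneg_of_mul_nonneg_right h hL)
    have ny : ∀ p q, 0 ≤ (yc θ e.tgt - yc θ e.src) * (proj e p - proj e q)
      - (xc θ e.src - xc θ e.tgt) * (height e p - height e q) → yc θ q ≤ yc θ p := by
      intro p q h
      rw [← lenSq_mul_yc] at h
      exact sub_nonneg.1 (nonneg_of_mul_nonneg_right h hL)
    obtain ⟨u, hu, hu1, hu2⟩ := W.left
    obtain ⟨v, hv, hv1, hv2⟩ := W.right
    refine ⟨θ, ⟨e.src_mem, key _ (height_src e)⟩, ⟨e.tgt_mem, key _ (height_tgt e)⟩,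
      ⟨?_, ⟨u, hu, nx _ _ hu1, ?_⟩, ⟨v, hv, ?_, ny _ _ hv1⟩⟩, ⟨nx _ _ ?_, ny _ _ ?_⟩,
      ⟨nx _ _ ?_, ny _ _ ?_⟩⟩
    · intro p hp h
      exact W.free p hp ⟨(hx θ a p).1 h.1, (hy θ a p).1 h.2⟩
    · have := lenSq_mul_yc e θ u a
      rw [hu2, sub_self, mul_eq_zero] at this
      linarith [this.resolve_left hL.ne']
    · have := lenSq_mul_xc e θ v a
      rw [hv2, sub_self, mul_eq_zero] at this
      linarith [this.resolve_left hL.ne']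
    · rw [proj_src, height_src]
      linarith [W.src_x]
    · rw [proj_src, height_src]
      linarith [W.src_y]
    · rw [proj_tgt, height_tgt]
      linarith [W.tgt_x]
    · rw [proj_tgt, height_tgt]
      linarith [W.tgt_y]

namespace IsWedge

variable {e : HullEdge P} {c s : ℝ} {a b p : Plane}

lemma height_le_of_left (W : IsWedge e c s a)
    (h : 0 ≤ -c * (proj e p - proj e a) - s * (height e p - height e a))
    (h' : s * (proj e p - proj e a) = c * (height e p - height e a)) :
    height e p ≤ height e a := by
  have hL := e.lenSq_pos
  have hs := mul_nonneg W.s_nonneg h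
  have : e.lenSq * (height e p - height e a)
      = -(s * (-c * (proj e p - proj e a) - s * (height e p - height e a))) := by
    rw [← W.norm]
    linear_combination (-c) * h'
  by_contra hc
  push Not at hc
  have := mul_pos hL (sub_pos.2 hc)
  linarith

lemma height_le_of_right (W : IsWedge e c s a)
    (h : 0 ≤ s * (proj e p - proj e a) - c * (height e p - height e a))
    (h' : -c * (proj e p - proj e a) = s * (height e p - height e a)) :
    height e p ≤ height e a := by
  have hL := e.lenSq_pos
  have hs := mul_nonneg W.c_nonneg h
  have : e.lenSq * (height e p - height e a)
      = -(c * (s * (proj e p - proj e a) - c * (height e p - height e a))) := by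
    rw [← W.norm]
    linear_combination (-s) * h'
  by_contra hc
  push Not at hc
  have := mul_pos hL (sub_pos.2 hc)
  linarith

lemma nonneg (W : IsWedge e c s a) : 0 ≤ height e a := by
  obtain ⟨u, hu, h1, h2⟩ := W.left
  exact (height_nonneg e hu).trans (W.height_le_of_left h1 h2)

lemma c_pos_or_s_pos (W : IsWedge e c s a) : 0 < c ∨ 0 < s := by
  by_contra hc
  push Not at hc
  have h1 := le_antisymm hc.1 W.c_nonneg
  have h2 := le_antisymm hc.2 W.s_nonneg
  have := W.norm
  have := e.lenSq_pos
  subst h1 h2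
  linarith

lemma proj_nonneg (W : IsWedge e c s a) : 0 ≤ proj e a := by
  have h1 := mul_nonneg W.c_nonneg W.src_x
  have h2 := mul_nonneg W.s_nonneg (sub_nonneg.2 W.src_y)
  refine nonneg_of_mul_nonneg_right ?_ e.lenSq_pos
  rw [← W.norm]
  linarith

lemma proj_le (W : IsWedge e c s a) : proj e a ≤ e.lenSq := by
  have h1 := mul_nonneg W.c_nonneg (sub_nonneg.2 W.tgt_x)
  have h2 := mul_nonneg W.s_nonneg W.tgt_y
  refine sub_nonneg.1 (nonneg_of_mul_nonneg_right ?_ e.lenSq_pos)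
  conv_rhs => enter [1]; rw [← W.norm]
  linarith

lemma pos_of_height_pos (W : IsWedge e c s a) (h : 0 < height e a) : 0 < c ∧ 0 < s := by
  have h1 := W.src_y
  have h2 := W.tgt_x
  rcases W.c_nonneg.lt_or_eq with hc | hc
  · refine ⟨hc, W.s_nonneg.lt_of_ne fun hs => ?_⟩
    rw [← hs] at h1
    nlinarith
  · rw [← hc] at h2
    have := W.c_pos_or_s_pos.resolve_left hc.ge.not_gt
    nlinarith

/-- On the line of `e`, the supporting points coincide with the apex. -/
lemma height_pos (W : IsWedge e c s a) (ha : a ∉ P) : 0 < height e a := by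
  refine W.nonneg.lt_of_ne fun h0 => ha ?_
  rcases W.s_nonneg.lt_or_eq with hs | hs
  · obtain ⟨u, hu, h1, h2⟩ := W.left
    have h3 := W.height_le_of_left h1 h2
    have h4 : height e u = height e a := le_antisymm h3 (h0 ▸ height_nonneg e hu)
    rw [h4, sub_self, mul_zero, mul_eq_zero] at h2
    rwa [← eq_of_proj_eq_of_height_eq e (sub_eq_zero.1 (h2.resolve_left hs.ne')) h4]
  · have hc := W.c_pos_or_s_pos.resolve_right hs.ge.not_gt
    obtain ⟨v, hv, h1, h2⟩ := W.right
    have h3 := W.height_le_of_right h1 h2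
    have h4 : height e v = height e a := le_antisymm h3 (h0 ▸ height_nonneg e hv)
    rw [h4, sub_self, mul_zero, mul_eq_zero] at h2
    rwa [← eq_of_proj_eq_of_height_eq e
      (sub_eq_zero.1 (h2.resolve_left (neg_ne_zero.2 hc.ne'))) h4]

/-- An empty wedge can be pushed along its left ray to a point supporting this ray. -/
lemma exists_left (W : IsWedge e c s a) (ha : a ∉ P) : ∃ u ∈ P, IsWedge e c s u ∧
    ∃ t, 0 < t ∧ proj e u = proj e a - t * c ∧ height e u = height e a - t * s := by
  obtain ⟨hc, hs⟩ := W.pos_of_height_pos (W.height_pos ha)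
  have hL := e.lenSq_pos
  have hn := W.norm
  obtain ⟨u, hu, h1, h2⟩ := W.left
  obtain ⟨t, ht⟩ : ∃ t, t = (-c * (proj e u - proj e a) - s * (height e u - height e a)) / e.lenSq :=
    ⟨_, rfl⟩
  rw [eq_div_iff hL.ne', ← hn] at ht
  have hn0 : c ^ 2 + s ^ 2 ≠ 0 := by rw [hn]; exact hL.ne'
  have hX : proj e u = proj e a - t * c := by
    refine mul_left_cancel₀ hn0 ?_
    linear_combination c * ht + s * h2
  have hY : height e u = height e a - t * s := by
    refine mul_left_cancel₀ hn0 ?_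
    linear_combination s * ht - c * h2
  have ht0 : 0 < t := by
    rw [← ht, hn] at h1
    refine (nonneg_of_mul_nonneg_left h1 hL).lt_of_ne fun h0 => ha ?_
    rw [← h0, zero_mul, sub_zero] at hX hY
    rwa [← eq_of_proj_eq_of_height_eq e hX hY]
  have hY0 := height_nonneg e hu
  have hsy : c * height e u ≤ s * proj e u := by
    rw [hX, hY]; linarith [W.src_y]
  have hX0 : 0 ≤ proj e u := nonneg_of_mul_nonneg_right ((mul_nonneg hc.le hY0).trans hsy) hs
  have htc : 0 < t * c := mul_pos ht0 hc
  refine ⟨u, hu, ⟨hc.le, hs.le, hn, ?_, ⟨u, hu, by simp, by simp⟩, ⟨u, hu, by simp, by simp⟩,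
    by positivity, hsy, ?_, ?_⟩, t, ht0, hX, hY⟩
  · rintro p hp ⟨k1, k2⟩
    refine W.free p hp ⟨?_, ?_⟩
    · have : 0 < t * (c ^ 2 + s ^ 2) := mul_pos ht0 (hn ▸ hL)
      rw [hX, hY] at k1
      linarith
    · rw [hX, hY] at k2
      linarith
  · rw [hX, hY]
    have : 0 < t * (c ^ 2 + s ^ 2) := mul_pos ht0 (hn ▸ hL)
    linarith [W.tgt_x]
  · have := W.proj_le
    have : 0 ≤ e.lenSq - proj e u := by linarith
    positivity

/-- An empty wedge can be pushed along its right ray to a point supporting this ray. -/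
lemma exists_right (W : IsWedge e c s a) (ha : a ∉ P) : ∃ v ∈ P, IsWedge e c s v ∧
    ∃ t, 0 < t ∧ proj e v = proj e a + t * s ∧ height e v = height e a - t * c := by
  obtain ⟨hc, hs⟩ := W.pos_of_height_pos (W.height_pos ha)
  have hL := e.lenSq_pos
  have hn := W.norm
  obtain ⟨v, hv, h1, h2⟩ := W.right
  obtain ⟨t, ht⟩ : ∃ t, t = (s * (proj e v - proj e a) - c * (height e v - height e a)) / e.lenSq :=
    ⟨_, rfl⟩
  rw [eq_div_iff hL.ne', ← hn] at ht
  have hn0 : c ^ 2 + s ^ 2 ≠ 0 := by rw [hn]; exact hL.ne'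
  have hX : proj e v = proj e a + t * s := by
    refine mul_left_cancel₀ hn0 ?_
    linear_combination (-s) * ht - c * h2
  have hY : height e v = height e a - t * c := by
    refine mul_left_cancel₀ hn0 ?_
    linear_combination c * ht - s * h2
  have ht0 : 0 < t := by
    rw [← ht, hn] at h1
    refine (nonneg_of_mul_nonneg_left h1 hL).lt_of_ne fun h0 => ha ?_
    rw [← h0, zero_mul] at hX hY
    rw [add_zero] at hX
    rw [sub_zero] at hY
    rwa [← eq_of_proj_eq_of_height_eq e hX hY]
  have hY0 := height_nonneg e hv
  have hsy : s * height e v ≤ c * (e.lenSq - proj e v) := by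
    rw [hX, hY]; linarith [W.tgt_x]
  have hX0 : 0 ≤ e.lenSq - proj e v :=
    nonneg_of_mul_nonneg_right ((mul_nonneg hs.le hY0).trans hsy) hc
  have hts : 0 < t * s := mul_pos ht0 hs
  have hX1 : 0 ≤ proj e v := by linarith [W.proj_nonneg]
  refine ⟨v, hv, ⟨hc.le, hs.le, hn, ?_, ⟨v, hv, by simp, by simp⟩, ⟨v, hv, by simp, by simp⟩,
    by positivity, ?_, hsy, by positivity⟩, t, ht0, hX, hY⟩
  · rintro p hp ⟨k1, k2⟩
    refine W.free p hp ⟨?_, ?_⟩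
    · rw [hX, hY] at k1
      linarith
    · have : 0 < t * (c ^ 2 + s ^ 2) := mul_pos ht0 (hn ▸ hL)
      rw [hX, hY] at k2
      linarith
  · rw [hX, hY]
    have : 0 < t * (c ^ 2 + s ^ 2) := mul_pos ht0 (hn ▸ hL)
    linarith [W.src_y]

/-- As the wedge is empty and opens downwards, the points of `P` to the left of the apex are not
below the line of its left ray. -/
lemma left_of_lt (W : IsWedge e c s b) (hp : p ∈ P) (h : proj e p < proj e b) :
    c * (height e b - height e p) ≤ s * (proj e b - proj e p) := by
  by_contra hc
  push Not at hc
  have h1 : 0 ≤ s * (proj e b - proj e p) := mul_nonneg W.s_nonneg (by linarith)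
  have h2 : 0 < c := W.c_nonneg.lt_of_ne (by rintro rfl; linarith)
  have h3 : 0 < height e b - height e p := pos_of_mul_pos_right (h1.trans_lt hc) h2.le
  refine W.free p hp ⟨?_, by linarith⟩
  have := mul_pos h2 (sub_pos.2 h)
  have := mul_nonneg W.s_nonneg h3.le
  linarith

/-- The points of `P` to the right of the apex are not below the line of its right ray. -/
lemma right_of_lt (W : IsWedge e c s b) (hp : p ∈ P) (h : proj e b < proj e p) :
    s * (height e b - height e p) ≤ c * (proj e p - proj e b) := by
  by_contra hc
  push Not at hc
  have h1 : 0 ≤ c * (proj e p - proj e b) := mul_nonneg W.c_nonneg (by linarith)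
  have h2 : 0 < s := W.s_nonneg.lt_of_ne (by rintro rfl; linarith)
  have h3 : 0 < height e b - height e p := pos_of_mul_pos_right (h1.trans_lt hc) h2.le
  refine W.free p hp ⟨by linarith, ?_⟩
  have := mul_pos h2 (sub_pos.2 h)
  have := mul_nonneg W.c_nonneg h3.le
  linarith

lemma le_height_of_proj_eq (W : IsWedge e c s b) (hp : p ∈ P) (h : proj e p = proj e b) :
    height e b ≤ height e p := by
  by_contra hc
  push Not at hc
  obtain ⟨h1, h2⟩ := W.pos_of_height_pos ((height_nonneg e hp).trans_lt hc)
  refine W.free p hp ⟨?_, ?_⟩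
  · rw [h, sub_self, mul_zero]
    nlinarith
  · rw [h, sub_self, mul_zero]
    nlinarith

end IsWedge

section Subchain

variable {e : HullEdge P} {a b k : Plane}

lemma eq_of_mem_of_proj_eq (ha : a ∈ P) (ha' : a ∈ subchain P e) (hb : b ∈ P)
    (hb' : b ∈ subchain P e) (h : proj e a = proj e b) : a = b := by
  obtain ⟨_, W⟩ := mem_subchain_iff.1 ha'
  obtain ⟨_, W'⟩ := mem_subchain_iff.1 hb'
  exact eq_of_proj_eq_of_height_eq e h
    (le_antisymm (W.le_height_of_proj_eq hb h.symm) (W'.le_height_of_proj_eq ha h))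

/-- No apex of an extremal quadrant on the subchain lies inside the empty wedge of a point of `P`
to its right. For points of `P` this is emptiness; for other apexes it follows from the position
of the two points supporting the apex. -/
lemma left_of_mem_subchain (ha : a ∈ subchain P e) (hb : b ∈ P) {c s : ℝ} (W : IsWedge e c s b)
    (hb' : b ∈ subchain P e) (h : proj e a ≤ proj e b) :
    c * (height e b - height e a) ≤ s * (proj e b - proj e a) := by
  have hP : ∀ p ∈ P, p ∈ subchain P e → proj e p ≤ proj e b →
      c * (height e b - height e p) ≤ s * (proj e b - proj e p) := by
    intro p hp hp' hpb
    rcases hpb.lt_or_eq with hlt | heq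
    · exact W.left_of_lt hp hlt
    · rw [eq_of_mem_of_proj_eq hp hp' hb hb' heq]
      simp
  by_cases haP : a ∈ P
  · exact hP a haP ha h
  obtain ⟨θ, A⟩ := mem_subchain_iff.1 ha
  have hx : 0 ≤ proj e b - proj e a := sub_nonneg.2 h
  rcases le_or_gt (height e b) (height e a) with hy | hy
  · exact (mul_nonpos_of_nonneg_of_nonpos W.c_nonneg (sub_nonpos.2 hy)).trans
      (mul_nonneg W.s_nonneg hx)
  obtain ⟨u, hu, hu', t, ht, hu1, hu2⟩ := A.exists_left haP
  obtain ⟨v, hv, hv', t', ht', hv1, hv2⟩ := A.exists_right haP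
  obtain ⟨hc', hs'⟩ := A.pos_of_height_pos (A.height_pos haP)
  set c' := xc θ e.src - xc θ e.tgt
  set s' := yc θ e.tgt - yc θ e.src
  have hvs : 0 < t' * s' := mul_pos ht' hs'
  have hvc : 0 < t' * c' := mul_pos ht' hc'
  have huc : 0 < t * c' := mul_pos ht hc'
  rcases le_or_gt (proj e v) (proj e b) with hvb | hvb
  · have h1 := hP v hv (mem_subchain_iff.2 ⟨θ, hv'⟩) hvb
    have h2 : c * (height e b - height e a) ≤ c * (height e b - height e v) :=
      mul_le_mul_of_nonneg_left (by linarith) W.c_nonneg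
    have h3 : s * (proj e b - proj e v) ≤ s * (proj e b - proj e a) :=
      mul_le_mul_of_nonneg_left (by linarith) W.s_nonneg
    linarith
  · have h1 := W.left_of_lt hu (by linarith)
    have h2 := W.right_of_lt hv hvb
    rw [hu1, hu2] at h1
    rw [hv1, hv2] at h2
    have h3 : 0 ≤ s * (height e b - height e a) := mul_nonneg W.s_nonneg (by linarith)
    have h4 : 0 ≤ c * (proj e b - proj e a) := mul_nonneg W.c_nonneg hx
    -- the wedge of `b` avoids both supporting points of `a`, which limits how it can be turned
    have h5 : s * c' - c * s' ≤ 0 := by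
      by_contra hcon
      push Not at hcon
      have := mul_pos ht' hcon
      linarith
    have h6 := mul_nonneg ht.le (neg_nonneg.2 h5)
    linarith

/-- The mirror image of `left_of_mem_subchain`. -/
lemma right_of_mem_subchain (ha : a ∈ subchain P e) (hb : b ∈ P) {c s : ℝ} (W : IsWedge e c s b)
    (hb' : b ∈ subchain P e) (h : proj e b ≤ proj e a) :
    s * (height e b - height e a) ≤ c * (proj e a - proj e b) := by
  have hP : ∀ p ∈ P, p ∈ subchain P e → proj e b ≤ proj e p →
      s * (height e b - height e p) ≤ c * (proj e p - proj e b) := by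
    intro p hp hp' hpb
    rcases hpb.lt_or_eq with hlt | heq
    · exact W.right_of_lt hp hlt
    · rw [eq_of_mem_of_proj_eq hp hp' hb hb' heq.symm]
      simp
  by_cases haP : a ∈ P
  · exact hP a haP ha h
  obtain ⟨θ, A⟩ := mem_subchain_iff.1 ha
  have hx : 0 ≤ proj e a - proj e b := sub_nonneg.2 h
  rcases le_or_gt (height e b) (height e a) with hy | hy
  · exact (mul_nonpos_of_nonneg_of_nonpos W.s_nonneg (sub_nonpos.2 hy)).trans
      (mul_nonneg W.c_nonneg hx)
  obtain ⟨u, hu, hu', t, ht, hu1, hu2⟩ := A.exists_left haP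
  obtain ⟨v, hv, hv', t', ht', hv1, hv2⟩ := A.exists_right haP
  obtain ⟨hc', hs'⟩ := A.pos_of_height_pos (A.height_pos haP)
  set c' := xc θ e.src - xc θ e.tgt
  set s' := yc θ e.tgt - yc θ e.src
  have hvs : 0 < t' * s' := mul_pos ht' hs'
  have hus : 0 < t * s' := mul_pos ht hs'
  have huc : 0 < t * c' := mul_pos ht hc'
  rcases le_or_gt (proj e b) (proj e u) with hvb | hvb
  · have h1 := hP u hu (mem_subchain_iff.2 ⟨θ, hu'⟩) hvb
    have h2 : s * (height e b - height e a) ≤ s * (height e b - height e u) :=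
      mul_le_mul_of_nonneg_left (by linarith) W.s_nonneg
    have h3 : c * (proj e u - proj e b) ≤ c * (proj e a - proj e b) :=
      mul_le_mul_of_nonneg_left (by linarith) W.c_nonneg
    linarith
  · have h1 := W.left_of_lt hu hvb
    have h2 := W.right_of_lt hv (by linarith)
    rw [hu1, hu2] at h1
    rw [hv1, hv2] at h2
    have h3 : 0 ≤ c * (height e b - height e a) := mul_nonneg W.c_nonneg (by linarith)
    have h4 : 0 ≤ s * (proj e a - proj e b) := mul_nonneg W.s_nonneg hx
    have h5 : c * s' - s * c' ≤ 0 := by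
      by_contra hcon
      push Not at hcon
      have := mul_pos ht hcon
      linarith
    have h6 := mul_nonneg ht'.le (neg_nonneg.2 h5)
    linarith

/-- Two slopes bounded by those of a right-angled wedge enclose at least a right angle. -/
lemma mul_le_mul_of_wedge {c s x x' y y' : ℝ} (hc : 0 ≤ c) (hs : 0 ≤ s) (hcs : 0 < c ∨ 0 < s)
    (hx : 0 ≤ x) (hx' : 0 ≤ x') (h : c * y ≤ s * x) (h' : s * y' ≤ c * x')
    (hy : 0 ≤ y ∨ 0 ≤ y') : y * y' ≤ x * x' := by
  have hxx := mul_nonneg hx hx'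
  rcases lt_or_ge 0 y with hy1 | hy1
  · rcases lt_or_ge 0 y' with hy2 | hy2
    · have hc0 : 0 < c := hc.lt_of_ne (by rintro rfl; nlinarith [hcs.resolve_left (lt_irrefl _)])
      have hs0 : 0 < s := hs.lt_of_ne (by rintro rfl; nlinarith)
      have h1 := mul_le_mul h h' (by positivity) (by positivity)
      refine le_of_mul_le_mul_left ?_ (mul_pos hc0 hs0)
      linarith
    · nlinarith
  · rcases hy with hy | hy
    · rw [le_antisymm hy1 hy]; linarith
    · nlinarith

/-- Seen from a point `b` of `P` on the subchain that is not below both of two other points of the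
subchain, one on each side, these two points enclose at least a right angle. -/
lemma star_of_mem_subchain (ha : a ∈ subchain P e) (hb : b ∈ P) (hb' : b ∈ subchain P e)
    (hk : k ∈ subchain P e) (hab : proj e a ≤ proj e b) (hbk : proj e b ≤ proj e k)
    (hy : height e a ≤ height e b ∨ height e k ≤ height e b) :
    (height e b - height e a) * (height e b - height e k) ≤
      (proj e b - proj e a) * (proj e k - proj e b) := by
  obtain ⟨_, W⟩ := mem_subchain_iff.1 hb'
  exact mul_le_mul_of_wedge W.c_nonneg W.s_nonneg W.c_pos_or_s_pos (sub_nonneg.2 hab)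
    (sub_nonneg.2 hbk) (left_of_mem_subchain ha hb W hb' hab)
    (right_of_mem_subchain hk hb W hb' hbk) (hy.imp sub_nonneg.2 sub_nonneg.2)

lemma subchain_subset_disk : subchain P e ⊆ e.disk := by
  intro a ha
  obtain ⟨_, W⟩ := mem_subchain_iff.1 ha
  rw [HullEdge.disk, mem_diameterDisk]
  have h1 := mul_le_mul_of_wedge W.c_nonneg W.s_nonneg W.c_pos_or_s_pos W.proj_nonneg
    (sub_nonneg.2 W.proj_le) W.src_y W.tgt_x (Or.inl W.nonneg)
  refine nonpos_of_mul_nonpos_right ?_ e.lenSq_pos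
  rw [lenSq_mul_dot, proj_src, proj_tgt, height_src, height_tgt]
  linarith

end Subchain

/-! ### Links lie in their disks -/

namespace Link

variable (l : Link P) {a : Plane}

/-- In the coordinates of the edge: the end points of a link are seen from the points of the link at
an angle of at least 90°. -/
lemma mul_le_mul_of_mem_carrier (ha : a ∈ l.carrier) :
    (height l.edge a - height l.edge l.fst) * (height l.edge a - height l.edge l.snd) ≤
      (proj l.edge a - proj l.edge l.fst) * (proj l.edge l.snd - proj l.edge a) := by
  obtain ⟨ha, h1, h2⟩ := ha
  by_cases haP : a ∈ P
  · have : proj l.edge a = proj l.edge l.fst ∨ proj l.edge a = proj l.edge l.snd := by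
      by_contra hc
      push Not at hc
      exact l.consecutive a haP ha ⟨h1.lt_of_ne hc.1.symm, h2.lt_of_ne hc.2⟩
    rcases this with h | h
    · rw [eq_of_mem_of_proj_eq haP ha l.fst_mem l.fst_mem_subchain h]
      simp
    · rw [eq_of_mem_of_proj_eq haP ha l.snd_mem l.snd_mem_subchain h]
      simp
  obtain ⟨θ, A⟩ := mem_subchain_iff.1 ha
  obtain ⟨u, hu, hu', t, ht, hu1, hu2⟩ := A.exists_left haP
  obtain ⟨v, hv, hv', t', ht', hv1, hv2⟩ := A.exists_right haP
  obtain ⟨hc', hs'⟩ := A.pos_of_height_pos (A.height_pos haP)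
  have hu'' := mem_subchain_iff.2 ⟨θ, hu'⟩
  have hv'' := mem_subchain_iff.2 ⟨θ, hv'⟩
  set c := xc θ l.edge.src - xc θ l.edge.tgt
  set s := yc θ l.edge.tgt - yc θ l.edge.src
  have huc := mul_pos ht hc'
  have hus := mul_pos ht hs'
  have hvc := mul_pos ht' hc'
  have hvs := mul_pos ht' hs'
  -- a point of `P` on the subchain never has the same projection as `a`
  have ne : ∀ b ∈ P, b ∈ subchain P l.edge → proj l.edge b ≠ proj l.edge a := by
    intro b hb hb' heq
    obtain ⟨_, B⟩ := mem_subchain_iff.1 hb'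
    have k1 := left_of_mem_subchain ha hb B hb' heq.ge
    have k2 := right_of_mem_subchain ha hb B hb' heq.le
    rw [heq, sub_self, mul_zero] at k1 k2
    have k3 := A.le_height_of_proj_eq hb heq
    refine haP ?_
    rwa [← eq_of_proj_eq_of_height_eq l.edge heq (le_antisymm ?_ k3)]
    rcases B.c_pos_or_s_pos with h | h
    · linarith [nonpos_of_mul_nonpos_right k1 h]
    · linarith [nonpos_of_mul_nonpos_right k2 h]
  have h1' := h1.lt_of_ne (ne _ l.fst_mem l.fst_mem_subchain)
  have h2' := h2.lt_of_ne (ne _ l.snd_mem l.snd_mem_subchain).symm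
  have hu3 : proj l.edge u ≤ proj l.edge l.fst := by
    by_contra hc
    push Not at hc
    exact l.consecutive u hu hu'' ⟨hc, by linarith⟩
  have hv3 : proj l.edge l.snd ≤ proj l.edge v := by
    by_contra hc
    push Not at hc
    exact l.consecutive v hv hv'' ⟨by linarith, hc⟩
  refine mul_le_mul_of_wedge A.c_nonneg A.s_nonneg A.c_pos_or_s_pos (sub_nonneg.2 h1)
    (sub_nonneg.2 h2) (A.left_of_lt l.fst_mem h1') (A.right_of_lt l.snd_mem h2') ?_
  -- the disk with diameter `uv` has points above `a` on one side of `a` only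
  by_contra hc
  push Not at hc
  obtain ⟨hc1, hc2⟩ := hc
  have k1 := star_of_mem_subchain hu'' l.fst_mem l.fst_mem_subchain hv'' hu3 (by linarith)
    (Or.inl (by linarith))
  have k2 := star_of_mem_subchain hu'' l.snd_mem l.snd_mem_subchain hv'' (by linarith) hv3
    (Or.inl (by linarith))
  rw [hu1, hu2, hv1, hv2] at k1 k2
  obtain ⟨x, hx⟩ : ∃ x, x = proj l.edge a - proj l.edge l.fst := ⟨_, rfl⟩
  obtain ⟨y, hy⟩ : ∃ x, x = height l.edge l.fst - height l.edge a := ⟨_, rfl⟩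
  obtain ⟨x', hx'⟩ : ∃ x, x = proj l.edge l.snd - proj l.edge a := ⟨_, rfl⟩
  obtain ⟨y', hy'⟩ : ∃ x, x = height l.edge l.snd - height l.edge a := ⟨_, rfl⟩
  rw [show proj l.edge l.fst = proj l.edge a - x by linarith,
    show height l.edge l.fst = height l.edge a + y by linarith] at k1
  rw [show proj l.edge l.snd = proj l.edge a + x' by linarith,
    show height l.edge l.snd = height l.edge a + y' by linarith] at k2
  have hx0 : 0 < x := by linarith
  have hy0 : 0 < y := by linarith
  have hx0' : 0 < x' := by linarith
  have hy0' : 0 < y' := by linarith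
  have q1 : 0 < x * (t * c - t' * s) := by
    have : 0 < y * (t * s + t' * c) := by positivity
    linarith [sq_nonneg x, sq_nonneg y]
  have q2 : 0 < x' * (t' * s - t * c) := by
    have : 0 < y' * (t * s + t' * c) := by positivity
    linarith [sq_nonneg x', sq_nonneg y']
  have := pos_of_mul_pos_right q1 hx0.le
  have := pos_of_mul_pos_right q2 hx0'.le
  linarith

lemma carrier_subset_disk : l.carrier ⊆ l.disk := by
  intro a ha
  rw [Link.disk, mem_diameterDisk]
  refine nonpos_of_mul_nonpos_right ?_ l.edge.lenSq_pos
  rw [lenSq_mul_dot]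
  linarith [l.mul_le_mul_of_mem_carrier ha]

lemma carrier_subset_edge_disk : l.carrier ⊆ l.edge.disk := fun _ ha =>
  subchain_subset_disk ha.1

lemma radius_pos : 0 < l.radius := by
  have : l.fst ≠ l.snd := fun h => l.lt.ne (by rw [h])
  exact half_pos (dist_pos.2 this)

lemma radius_le_edge_radius : l.radius ≤ l.edge.radius := by
  have h1 := subchain_subset_disk l.fst_mem_subchain
  have h2 := subchain_subset_disk l.snd_mem_subchain
  have := dist_triangle_right l.fst l.snd (midpoint ℝ l.edge.src l.edge.tgt)
  unfold HullEdge.disk diameterDisk at h1 h2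
  rw [Metric.mem_closedBall] at h1 h2
  unfold radius HullEdge.radius
  linarith

lemma ext_of_edge_of_fst {l m : Link P} (h : l.edge = m.edge) (h' : l.fst = m.fst) : l = m := by
  have : l.snd = m.snd := by
    refine eq_of_mem_of_proj_eq (e := l.edge) l.snd_mem l.snd_mem_subchain m.snd_mem
      (h ▸ m.snd_mem_subchain) (le_antisymm ?_ ?_)
    · by_contra hc
      push Not at hc
      refine l.consecutive m.snd m.snd_mem (h ▸ m.snd_mem_subchain) ⟨?_, hc⟩
      rw [h, h']
      exact m.lt
    · by_contra hc
      push Not at hc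
      refine m.consecutive l.snd l.snd_mem (h ▸ l.snd_mem_subchain) ⟨?_, h ▸ hc⟩
      rw [← h, ← h']
      exact l.lt
  exact Link.ext h h' this

end Link

/-! ### Every point lies in at most four edge-disks -/

/-- The determinant of two plane vectors. -/
def cross (u v : Plane) : ℝ := u 0 * v 1 - u 1 * v 0

/-- `u` rotated counterclockwise by a right angle. -/
def rot (u : Plane) : Plane := !₂[-u 1, u 0]

@[simp] lemma rot_zero (u : Plane) : rot u 0 = -u 1 := rfl
@[simp] lemma rot_one (u : Plane) : rot u 1 = u 0 := rfl

/-- For `0 < cross s t`, the vectors `d` in the sector from `s` counterclockwise to `t`, with the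
ray of `t` included and that of `s` excluded. -/
def InSector (s t d : Plane) : Prop := 0 < cross s d ∧ 0 ≤ cross d t

/-- A sector of at least 90° contains one of four perpendicular directions. -/
lemma exists_axis_inSector {f s t : Plane} (hf : f 0 ^ 2 + f 1 ^ 2 ≠ 0) (h : 0 < cross s t)
    (hst : s 0 * t 0 + s 1 * t 1 ≤ 0) :
    InSector s t f ∨ InSector s t (rot f) ∨ InSector s t (-f) ∨ InSector s t (-rot f) := by
  have hs : 0 < s 0 ^ 2 + s 1 ^ 2 := by
    refine (by positivity : 0 ≤ s 0 ^ 2 + s 1 ^ 2).lt_of_ne fun h0 => ?_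
    have h1 : s 0 = 0 := by nlinarith [sq_nonneg (s 0), sq_nonneg (s 1)]
    have h2 : s 1 = 0 := by nlinarith [sq_nonneg (s 0), sq_nonneg (s 1)]
    simp [cross, h1, h2] at h
  -- the first axis met when turning counterclockwise from `s` is at an angle of at most 90°
  have key : ∀ d : Plane, 0 < cross s d → 0 ≤ s 0 * d 0 + s 1 * d 1 → InSector s t d := by
    intro d h1 h2
    refine ⟨h1, nonneg_of_mul_nonneg_right ?_ hs⟩
    have e : (s 0 ^ 2 + s 1 ^ 2) * cross d t =
        (s 0 * d 0 + s 1 * d 1) * cross s t + cross s d * -(s 0 * t 0 + s 1 * t 1) := by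
      simp only [cross]; ring
    rw [e]
    exact add_nonneg (mul_nonneg h2 h.le) (mul_nonneg h1.le (neg_nonneg.2 hst))
  have hn : (s 0 ^ 2 + s 1 ^ 2) * (f 0 ^ 2 + f 1 ^ 2) =
      cross s f ^ 2 + (s 0 * f 0 + s 1 * f 1) ^ 2 := by simp only [cross]; ring
  have c1 : cross s (rot f) = s 0 * f 0 + s 1 * f 1 := by simp [cross]
  have c2 : cross s (-f) = -cross s f := by simp [cross]; ring
  have c3 : cross s (-rot f) = -(s 0 * f 0 + s 1 * f 1) := by simp [cross]; ring
  have d1 : s 0 * rot f 0 + s 1 * rot f 1 = - cross s f := by simp [cross]; ring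
  have d2 : s 0 * (-f) 0 + s 1 * (-f) 1 = -(s 0 * f 0 + s 1 * f 1) := by simp; ring
  have d3 : s 0 * (-rot f) 0 + s 1 * (-rot f) 1 = cross s f := by simp [cross]; ring
  rcases lt_trichotomy (cross s f) 0 with hA | hA | hA
  · rcases lt_or_ge 0 (s 0 * f 0 + s 1 * f 1) with hB | hB
    · exact Or.inr (Or.inl (key _ (c1 ▸ hB) (by rw [d1]; linarith)))
    · exact Or.inr (Or.inr (Or.inl (key _ (by rw [c2]; linarith) (by rw [d2]; linarith))))
  · rcases lt_trichotomy 0 (s 0 * f 0 + s 1 * f 1) with hB | hB | hB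
    · exact Or.inr (Or.inl (key _ (c1 ▸ hB) (by rw [d1]; linarith)))
    · rw [hA, ← hB] at hn
      exact absurd hn (by simpa using ⟨hs.ne', hf⟩)
    · exact Or.inr (Or.inr (Or.inr (key _ (by rw [c3]; linarith) (by rw [d3]; linarith))))
  · rcases lt_or_ge (s 0 * f 0 + s 1 * f 1) 0 with hB | hB
    · exact Or.inr (Or.inr (Or.inr (key _ (by rw [c3]; linarith) (by rw [d3]; linarith))))
    · exact Or.inl (key _ hA hB)

/-- If the ray from the origin in direction `d` crosses the segments `st` and `s't'`, and each
segment lies on the same side (given by `η`) of the line of the other one, then the ray crosses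
them at the same point; as it does not pass through `s` or `s'`, the points `t` and `t'` lie on
the lines of `s't'` and `st`. -/
lemma cross_eq_zero_of_inSector {s t s' t' d : Plane} {η : ℝ} (hη : η ≠ 0)
    (h : InSector s t d) (h' : InSector s' t' d)
    (h1 : 0 ≤ η * cross (t - s) (s' - s)) (h2 : 0 ≤ η * cross (t - s) (t' - s))
    (h3 : 0 ≤ η * cross (t' - s') (s - s')) (h4 : 0 ≤ η * cross (t' - s') (t - s')) :
    cross (t - s) (t' - s) = 0 ∧ cross (t' - s') (t - s') = 0 := by
  have e : cross d t' * (η * cross (t - s) (s' - s)) + cross s' d * (η * cross (t - s) (t' - s))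
      + (cross d t * (η * cross (t' - s') (s - s')) + cross s d * (η * cross (t' - s') (t - s')))
      = 0 := by
    simp only [cross, PiLp.sub_apply]; ring
  have p1 := mul_nonneg h'.2 h1
  have p2 := mul_nonneg h'.1.le h2
  have p3 := mul_nonneg h.2 h3
  have p4 := mul_nonneg h.1.le h4
  have q2 : cross s' d * (η * cross (t - s) (t' - s)) = 0 := by linarith
  have q4 : cross s d * (η * cross (t' - s') (t - s')) = 0 := by linarith
  simp only [mul_eq_zero, hη, h.1.ne', h'.1.ne', false_or] at q2 q4
  exact ⟨q2, q4⟩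

/-- A sector between two vectors on one side of a line is on that side, and it touches the line at
most along its closed side. -/
lemma cross_nonneg_of_inSector {f s t d : Plane} (h : 0 < cross s t) (hd : InSector s t d)
    (hs : 0 ≤ cross f s) (ht : 0 ≤ cross f t) :
    0 ≤ cross f d ∧ (cross f d = 0 → cross f t = 0) := by
  have e : cross s t * cross f d = cross d t * cross f s + cross s d * cross f t := by
    simp only [cross]; ring
  have p1 := mul_nonneg hd.2 hs
  have p2 := mul_nonneg hd.1.le ht
  refine ⟨nonneg_of_mul_nonneg_right (by rw [e]; positivity) h, fun h0 => ?_⟩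
  rw [h0, mul_zero] at e
  have : cross s d * cross f t = 0 := by linarith
  exact (mul_eq_zero.1 this).resolve_left hd.1.ne'

lemma height_eq_cross (e : HullEdge P) (p x : Plane) :
    height e p = cross ((e.tgt - x) - (e.src - x)) ((p - x) - (e.src - x)) := by
  simp only [height, cross, PiLp.sub_apply]; ring

namespace HullEdge

variable {e e' : HullEdge P} {x : Plane}

lemma eq_of_src_eq (hP : NoThreeCollinear P) (h : e.src = e'.src) : e = e' := by
  have h1 := height_nonneg e e'.tgt_mem
  have h2 := height_nonneg e' e.tgt_mem
  unfold height at h1 h2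
  rw [← h] at h2
  have h3 : height e e'.tgt = 0 := by unfold height; linarith
  rcases hP.eq_src_or_eq_tgt e e'.tgt_mem h3 with h4 | h4
  · exact absurd (h.symm.trans h4.symm) e'.ne
  · exact HullEdge.ext h h4.symm

lemma eq_of_tgt_eq (hP : NoThreeCollinear P) (h : e.tgt = e'.tgt) : e = e' := by
  have h1 := height_nonneg e e'.src_mem
  have h2 := height_nonneg e' e.src_mem
  unfold height at h1 h2
  rw [← h] at h2
  have h3 : height e e'.src = 0 := by unfold height; linarith
  rcases hP.eq_src_or_eq_tgt e e'.src_mem h3 with h4 | h4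
  · exact HullEdge.ext h4.symm h
  · exact absurd (h4.trans h) e'.ne

lemma mem_disk : x ∈ e.disk ↔
    (e.src - x) 0 * (e.tgt - x) 0 + (e.src - x) 1 * (e.tgt - x) 1 ≤ 0 := mem_diameterDisk

/-- A ray leaves the convex hull through a unique hull edge. -/
lemma eq_of_inSector_of_left (hP : NoThreeCollinear P) {d : Plane}
    (h : InSector (e.src - x) (e.tgt - x) d) (h' : InSector (e'.src - x) (e'.tgt - x) d) :
    e = e' := by
  obtain ⟨h1, h2⟩ := cross_eq_zero_of_inSector (η := 1) one_ne_zero h h'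
    (by rw [one_mul, ← height_eq_cross]; exact height_nonneg e e'.src_mem)
    (by rw [one_mul, ← height_eq_cross]; exact height_nonneg e e'.tgt_mem)
    (by rw [one_mul, ← height_eq_cross]; exact height_nonneg e' e.src_mem)
    (by rw [one_mul, ← height_eq_cross]; exact height_nonneg e' e.tgt_mem)
  rw [← height_eq_cross] at h1 h2
  rcases hP.eq_src_or_eq_tgt e e'.tgt_mem h1 with h3 | h3
  · rcases hP.eq_src_or_eq_tgt e' e.tgt_mem h2 with h4 | h4
    · exfalso
      have k1 := h.1
      have k2 := h.2
      have k3 := h'.1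
      have k4 := h'.2
      rw [← h4] at k3
      unfold cross at *
      linarith
    · exact absurd (h4.trans h3).symm e.ne
  · exact eq_of_tgt_eq hP h3.symm

/-- A ray enters the convex hull through a unique hull edge. -/
lemma eq_of_inSector_of_right (hP : NoThreeCollinear P) {d : Plane}
    (h : InSector (e.tgt - x) (e.src - x) d) (h' : InSector (e'.tgt - x) (e'.src - x) d) :
    e = e' := by
  have flip : ∀ (e : HullEdge P) (p : Plane),
      -1 * cross ((e.src - x) - (e.tgt - x)) ((p - x) - (e.tgt - x)) = height e p := by
    intro e p
    simp only [height, cross, PiLp.sub_apply]; ring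
  obtain ⟨h1, h2⟩ := cross_eq_zero_of_inSector (η := -1) (by norm_num) h h'
    (by rw [flip]; exact height_nonneg e e'.tgt_mem)
    (by rw [flip]; exact height_nonneg e e'.src_mem)
    (by rw [flip]; exact height_nonneg e' e.tgt_mem)
    (by rw [flip]; exact height_nonneg e' e.src_mem)
  replace h1 : height e e'.src = 0 := by rw [← flip, h1, mul_zero]
  replace h2 : height e' e.src = 0 := by rw [← flip, h2, mul_zero]
  rcases hP.eq_src_or_eq_tgt e e'.src_mem h1 with h3 | h3
  · exact eq_of_src_eq hP h3.symm
  · rcases hP.eq_src_or_eq_tgt e' e.src_mem h2 with h4 | h4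
    · exact absurd (h4.trans h3) e.ne
    · exfalso
      have k1 := h.1
      have k2 := h.2
      have k3 := h'.1
      rw [← h4] at k3
      unfold cross at *
      linarith

end HullEdge

lemma encard_le_four {α : Type*} {E A B C D : Set α} (h : E ⊆ A ∪ B ∪ C ∪ D)
    (hA : A.Subsingleton) (hB : B.Subsingleton) (hC : C.Subsingleton) (hD : D.Subsingleton) :
    E.encard ≤ 4 := by
  have h1 : ∀ {S : Set α}, S.Subsingleton → S.encard ≤ 1 :=
    fun hS => Set.encard_le_one_iff_subsingleton.2 hS
  calc E.encard ≤ (A ∪ B ∪ C ∪ D).encard := Set.encard_le_encard h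
    _ ≤ A.encard + B.encard + C.encard + D.encard := by
      refine (Set.encard_union_le _ _).trans ?_
      gcongr
      refine (Set.encard_union_le _ _).trans ?_
      gcongr
      exact Set.encard_union_le _ _
    _ ≤ 1 + 1 + 1 + 1 := by gcongr <;> exact h1 ‹_›
    _ = 4 := by norm_num

/-- The case of a point `x` strictly outside the convex hull: no ray from `x` meets more than one
near and one far edge. -/
lemma encard_disk_le_of_right (hP : NoThreeCollinear P) {x : Plane} (e₀ : HullEdge P)
    (h₀ : cross (e₀.src - x) (e₀.tgt - x) < 0) : {e : HullEdge P | x ∈ e.disk}.encard ≤ 4 := by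
  set f : Plane := e₀.tgt - e₀.src with hf
  have hfn : f 0 ^ 2 + f 1 ^ 2 ≠ 0 := e₀.lenSq_pos.ne'
  have hfp : 0 < f 0 ^ 2 + f 1 ^ 2 := e₀.lenSq_pos
  have hν : ∀ p ∈ P, 0 < cross f (p - x) := by
    intro p hp
    have := height_nonneg e₀ hp
    simp only [hf, cross, height, PiLp.sub_apply] at *
    linarith
  -- all points of `P` lie on one side of a line through `x`, so only one axis meets the hull
  have axis : ∀ s t : Plane, 0 < cross s t → s 0 * t 0 + s 1 * t 1 ≤ 0 → 0 < cross f s →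
      0 < cross f t → InSector s t (rot f) := by
    intro s t h h' hs ht
    have c1 : cross f f = 0 := by simp only [cross]; ring
    have c2 : cross f (-f) = 0 := by simp [cross]; ring
    have c3 : cross f (-rot f) = -(f 0 ^ 2 + f 1 ^ 2) := by simp [cross]; ring
    rcases exists_axis_inSector hfn h h' with k | k | k | k
    · exact absurd ((cross_nonneg_of_inSector h k hs.le ht.le).2 c1) ht.ne'
    · exact k
    · exact absurd ((cross_nonneg_of_inSector h k hs.le ht.le).2 c2) ht.ne'
    · have := (cross_nonneg_of_inSector h k hs.le ht.le).1
      linarith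
  refine encard_le_four (A := {e | x ∈ e.disk ∧ 0 < cross (e.src - x) (e.tgt - x)})
    (B := {e | x ∈ e.disk ∧ 0 < cross (e.tgt - x) (e.src - x)}) (C := ∅) (D := ∅) ?_ ?_ ?_
    Set.subsingleton_empty Set.subsingleton_empty
  · intro e he
    left; left
    have hs := hν _ e.src_mem
    have ht := hν _ e.tgt_mem
    rcases lt_trichotomy (cross (e.src - x) (e.tgt - x)) 0 with h | h | h
    · right
      refine ⟨he, ?_⟩
      have : cross (e.tgt - x) (e.src - x) = - cross (e.src - x) (e.tgt - x) := by
        simp only [cross]; ring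
      linarith
    · exfalso
      have he' := HullEdge.mem_disk.1 he
      generalize e.src - x = s at *
      generalize e.tgt - x = t at *
      have e1 : (f 0 * s 0 + f 1 * s 1) * cross f t = (f 0 * t 0 + f 1 * t 1) * cross f s := by
        have : (f 0 * s 0 + f 1 * s 1) * cross f t - (f 0 * t 0 + f 1 * t 1) * cross f s
          = (f 0 ^ 2 + f 1 ^ 2) * cross s t := by simp only [cross]; ring
        rw [h, mul_zero] at this
        linarith
      have e2 : (f 0 * s 0 + f 1 * s 1) * (f 0 * t 0 + f 1 * t 1) + cross f s * cross f t
          = (f 0 ^ 2 + f 1 ^ 2) * (s 0 * t 0 + s 1 * t 1) := by simp only [cross]; ring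
      have e3 := mul_nonneg hfp.le (neg_nonneg.2 he')
      have e4 := mul_pos hs ht
      have e5 : 0 ≤ ((f 0 * s 0 + f 1 * s 1) * (f 0 * t 0 + f 1 * t 1)) * cross f t := by
        rw [show (f 0 * s 0 + f 1 * s 1) * (f 0 * t 0 + f 1 * t 1) * cross f t
          = (f 0 * t 0 + f 1 * t 1) * ((f 0 * s 0 + f 1 * s 1) * cross f t) by ring, e1]
        have := mul_nonneg (sq_nonneg (f 0 * t 0 + f 1 * t 1)) hs.le
        linarith
      have e6 := nonneg_of_mul_nonneg_left e5 ht
      linarith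
    · exact Or.inl ⟨he, h⟩
  · rintro e ⟨he, hl⟩ e' ⟨he', hl'⟩
    exact HullEdge.eq_of_inSector_of_left hP
      (axis _ _ hl (HullEdge.mem_disk.1 he) (hν _ e.src_mem) (hν _ e.tgt_mem))
      (axis _ _ hl' (HullEdge.mem_disk.1 he') (hν _ e'.src_mem) (hν _ e'.tgt_mem))
  · rintro e ⟨he, hl⟩ e' ⟨he', hl'⟩
    rw [HullEdge.mem_disk] at he he'
    exact HullEdge.eq_of_inSector_of_right hP
      (axis _ _ hl (by linarith) (hν _ e.tgt_mem) (hν _ e.src_mem))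
      (axis _ _ hl' (by linarith) (hν _ e'.tgt_mem) (hν _ e'.src_mem))

/-- If the origin lies between `s` and `t` on a line and both are weakly on the same side of another
line through the origin, then they are on that line. -/
lemma eq_zero_of_cross_eq_zero {f s t : Plane} (h : cross s t = 0)
    (hst : s 0 * t 0 + s 1 * t 1 ≤ 0) (ht : t ≠ 0) (hfs : 0 ≤ cross f s) (hft : 0 ≤ cross f t) :
    cross f s = 0 := by
  have htt : 0 < t 0 ^ 2 + t 1 ^ 2 := by
    refine (by positivity : 0 ≤ t 0 ^ 2 + t 1 ^ 2).lt_of_ne fun h0 => ht (plane_ext ?_ ?_)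
    · simp; nlinarith [sq_nonneg (t 0), sq_nonneg (t 1)]
    · simp; nlinarith [sq_nonneg (t 0), sq_nonneg (t 1)]
  have e : (t 0 ^ 2 + t 1 ^ 2) * cross f s - (s 0 * t 0 + s 1 * t 1) * cross f t
      = -(f 0 * t 0 + f 1 * t 1) * cross s t := by
    simp only [cross]; ring
  rw [h, mul_zero] at e
  have := mul_nonneg (neg_nonneg.2 hst) hft
  refine le_antisymm ?_ hfs
  by_contra hc
  push Not at hc
  have := mul_pos htt hc
  linarith

/-- The case of a point `x` on a hull edge: at most two of the four directions point to an edge that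
does not contain `x`, and at most two edges contain `x`. -/
lemma encard_disk_le_of_on (hP : NoThreeCollinear P) {x : Plane} (e₀ : HullEdge P)
    (hx₀ : x ∈ e₀.disk) (h₀ : cross (e₀.src - x) (e₀.tgt - x) = 0)
    (hall : ∀ e : HullEdge P, x ∈ e.disk → 0 ≤ cross (e.src - x) (e.tgt - x)) :
    {e : HullEdge P | x ∈ e.disk}.encard ≤ 4 := by
  set f : Plane := e₀.tgt - e₀.src with hf
  have hfn : f 0 ^ 2 + f 1 ^ 2 ≠ 0 := e₀.lenSq_pos.ne'
  have hfp : 0 < f 0 ^ 2 + f 1 ^ 2 := e₀.lenSq_pos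
  have hνh : ∀ p, cross f (p - x) = height e₀ p := by
    intro p
    simp only [hf, cross, height, PiLp.sub_apply] at *
    linarith
  have hν : ∀ p ∈ P, 0 ≤ cross f (p - x) := fun p hp => hνh p ▸ height_nonneg e₀ hp
  have hhx : ∀ e : HullEdge P, height e x = cross (e.src - x) (e.tgt - x) := by
    intro e
    simp only [cross, height, PiLp.sub_apply]
    ring
  -- an edge through `x` with another source than `e₀` is determined by one fixed end point
  have hD : ∃ y, ∀ e : HullEdge P, x ∈ e.disk → cross (e.src - x) (e.tgt - x) = 0 →
      e.src ≠ e₀.src → e.src = y ∨ e.tgt = y ∧ e₀.src = y := by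
    by_cases hxP : x ∈ P
    · refine ⟨x, fun e he hc hne => ?_⟩
      rcases hP.eq_src_or_eq_tgt e hxP (by rw [hhx, hc]) with h | h
      · exact Or.inl h.symm
      · rcases hP.eq_src_or_eq_tgt e₀ hxP (by rw [hhx, h₀]) with h' | h'
        · exact Or.inr ⟨h.symm, h'.symm⟩
        · exact absurd (congrArg HullEdge.src (HullEdge.eq_of_tgt_eq hP (h.symm.trans h'))) hne
    · refine ⟨e₀.tgt, fun e he hc hne => ?_⟩
      have ht : e.tgt - x ≠ 0 := by
        rw [sub_ne_zero]
        rintro rfl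
        exact hxP e.tgt_mem
      have := eq_zero_of_cross_eq_zero hc (HullEdge.mem_disk.1 he) ht (hν _ e.src_mem)
        (hν _ e.tgt_mem)
      rw [hνh] at this
      exact Or.inl ((hP.eq_src_or_eq_tgt e₀ e.src_mem this).resolve_left hne)
  obtain ⟨y, hy⟩ := hD
  refine encard_le_four
    (A := {e | 0 < cross (e.src - x) (e.tgt - x) ∧ InSector (e.src - x) (e.tgt - x) (rot f)})
    (B := {e | 0 < cross (e.src - x) (e.tgt - x) ∧ InSector (e.src - x) (e.tgt - x) (-f)})
    (C := {e | e.src = e₀.src})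
    (D := {e | x ∈ e.disk ∧ cross (e.src - x) (e.tgt - x) = 0 ∧ e.src ≠ e₀.src}) ?_ ?_ ?_ ?_ ?_
  · intro e he
    rcases (hall e he).lt_or_eq with h | h
    · left; left
      have c1 : cross f f = 0 := by simp only [cross]; ring
      have c3 : cross f (-rot f) = -(f 0 ^ 2 + f 1 ^ 2) := by simp [cross]; ring
      have hs := hν _ e.src_mem
      rcases exists_axis_inSector hfn h (HullEdge.mem_disk.1 he) with k | k | k | k
      · exfalso
        have := k.1
        have : cross (e.src - x) f = - cross f (e.src - x) := by simp only [cross]; ring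
        linarith
      · exact Or.inl ⟨h, k⟩
      · exact Or.inr ⟨h, k⟩
      · have := (cross_nonneg_of_inSector h k hs (hν _ e.tgt_mem)).1
        linarith
    · by_cases hs : e.src = e₀.src
      · exact Or.inl (Or.inr hs)
      · exact Or.inr ⟨he, h.symm, hs⟩
  · rintro e ⟨h, k⟩ e' ⟨h', k'⟩
    exact HullEdge.eq_of_inSector_of_left hP k k'
  · rintro e ⟨h, k⟩ e' ⟨h', k'⟩
    exact HullEdge.eq_of_inSector_of_left hP k k'
  · rintro e h e' h'
    exact HullEdge.eq_of_src_eq hP (h.trans h'.symm)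
  · rintro e ⟨h1, h2, h3⟩ e' ⟨h1', h2', h3'⟩
    rcases hy e h1 h2 h3 with h | h <;> rcases hy e' h1' h2' h3' with h' | h'
    · exact HullEdge.eq_of_src_eq hP (h.trans h'.symm)
    · exact absurd (h.trans h'.2.symm) h3
    · exact absurd (h'.trans h.2.symm) h3'
    · exact HullEdge.eq_of_tgt_eq hP (h.1.trans h'.1.symm)

/-- Every point lies in at most four edge-disks. -/
theorem encard_disk_le_four (hP : NoThreeCollinear P) (x : Plane) :
    {e : HullEdge P | x ∈ e.disk}.encard ≤ 4 := by
  by_cases h1 : ∃ e₀ : HullEdge P, cross (e₀.src - x) (e₀.tgt - x) < 0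
  · obtain ⟨e₀, h⟩ := h1
    exact encard_disk_le_of_right hP e₀ h
  push Not at h1
  by_cases h2 : ∃ e₀ : HullEdge P, x ∈ e₀.disk ∧ cross (e₀.src - x) (e₀.tgt - x) = 0
  · obtain ⟨e₀, h, h'⟩ := h2
    exact encard_disk_le_of_on hP e₀ h h' fun e _ => h1 e
  push Not at h2
  set f : Plane := !₂[1, 0]
  have hf : f 0 ^ 2 + f 1 ^ 2 ≠ 0 := by simp [f]
  have key : ∀ d, {e : HullEdge P | 0 < cross (e.src - x) (e.tgt - x) ∧
      InSector (e.src - x) (e.tgt - x) d}.Subsingleton := by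
    rintro d e ⟨h, k⟩ e' ⟨h', k'⟩
    exact HullEdge.eq_of_inSector_of_left hP k k'
  refine encard_le_four ?_ (key f) (key (rot f)) (key (-f)) (key (-rot f))
  intro e he
  have h := (h1 e).lt_of_ne (h2 e he).symm
  rcases exists_axis_inSector hf h (HullEdge.mem_disk.1 he) with k | k | k | k
  · exact Or.inl (Or.inl (Or.inl ⟨h, k⟩))
  · exact Or.inl (Or.inl (Or.inr ⟨h, k⟩))
  · exact Or.inl (Or.inr ⟨h, k⟩)
  · exact Or.inr ⟨h, k⟩

/-! ### Covering and counting -/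

lemma encard_biUnion_le_mul {ι α : Type*} {I : Set ι} {f : ι → Set α} {n k : ℕ}
    (hI : I.encard ≤ n) (hf : ∀ i ∈ I, (f i).encard ≤ k) :
    (⋃ i ∈ I, f i).encard ≤ (n * k : ℕ) := by
  have hfin : I.Finite := Set.finite_of_encard_le_coe hI
  lift I to Finset ι using hfin
  refine (I.set_encard_biUnion_le f).trans ((Finset.sum_le_card_nsmul I _ (k : ℕ∞) hf).trans ?_)
  rw [Set.encard_coe_eq_coe_finsetCard] at hI
  rw [nsmul_eq_mul, Nat.cast_mul]
  gcongr

/-- A disk of radius `2` is covered by seven unit disks. -/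
lemma exists_unit_cover : ∃ z : Fin 7 → ℝ × ℝ, ∀ x y : ℝ, x ^ 2 + y ^ 2 ≤ 4 →
    ∃ k, (x - (z k).1) ^ 2 + (y - (z k).2) ^ 2 ≤ 1 := by
  obtain ⟨h, hh⟩ : ∃ h, h = √3 := ⟨_, rfl⟩
  have hpos : 0 < h := by rw [hh]; positivity
  have hsq : h ^ 2 = 3 := by rw [hh]; exact Real.sq_sqrt (by norm_num)
  refine ⟨![(0, 0), (h, 0), (-h, 0), (h / 2, 3 / 2), (-h / 2, 3 / 2), (h / 2, -3 / 2),
    (-h / 2, -3 / 2)], fun x y hxy => ?_⟩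
  rcases le_total (x ^ 2 + y ^ 2) 1 with h1 | h1
  · exact ⟨0, by simpa using h1⟩
  -- the closest of the six outer centers is at an angle of at most 30°
  obtain ⟨n, hn⟩ : ∃ n, n = √(x ^ 2 + y ^ 2) := ⟨_, rfl⟩
  have hnsq : n ^ 2 = x ^ 2 + y ^ 2 := by rw [hn]; exact Real.sq_sqrt (by positivity)
  have hn0 : 0 ≤ n := by rw [hn]; positivity
  have hn1 : 1 ≤ n := by nlinarith
  have hn2 : n ≤ 2 := by nlinarith
  have hquad : x ^ 2 + y ^ 2 + 2 ≤ 3 * n := by nlinarith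
  have habs : |x| ^ 2 + |y| ^ 2 = n ^ 2 := by rw [sq_abs, sq_abs, hnsq]
  rcases le_total (h * |y|) |x| with hc | hc
  · have hb : 3 * n ≤ 2 * h * |x| := by
      refine (sq_le_sq₀ (by positivity) (by positivity)).1 ?_
      have := mul_self_le_mul_self (by positivity) hc
      nlinarith
    rcases abs_cases x with ⟨hx, -⟩ | ⟨hx, -⟩ <;> rw [hx] at hb
    · exact ⟨1, by simp; nlinarith⟩
    · exact ⟨2, by simp; nlinarith⟩
  · have hb : 3 * n ≤ h * |x| + 3 * |y| := by
      refine (sq_le_sq₀ (by positivity) (by positivity)).1 ?_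
      have := mul_le_mul_of_nonneg_left hc (abs_nonneg x)
      nlinarith
    rcases abs_cases x with ⟨hx, -⟩ | ⟨hx, -⟩ <;> rcases abs_cases y with ⟨hy, -⟩ | ⟨hy, -⟩ <;>
      rw [hx, hy] at hb
    · exact ⟨3, by simp; nlinarith⟩
    · exact ⟨5, by simp; nlinarith⟩
    · exact ⟨4, by simp; nlinarith⟩
    · exact ⟨6, by simp; nlinarith⟩

lemma exists_cover (c : Plane) {r : ℝ} (hr : 0 < r) : ∃ z : Fin 7 → Plane,
    ∀ w, dist w c ≤ 2 * r → ∃ k, dist w (z k) ≤ r := by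
  obtain ⟨z, hz⟩ := exists_unit_cover
  refine ⟨fun k => !₂[c 0 + r * (z k).1, c 1 + r * (z k).2], fun w hw => ?_⟩
  have h1 : ((w 0 - c 0) / r) ^ 2 + ((w 1 - c 1) / r) ^ 2 ≤ 4 := by
    rw [div_pow, div_pow, ← add_div, div_le_iff₀ (by positivity), ← dist_sq_eq]
    calc dist w c ^ 2 ≤ (2 * r) ^ 2 := by gcongr
      _ = 4 * r ^ 2 := by ring
  obtain ⟨k, hk⟩ := hz _ _ h1
  refine ⟨k, (sq_le_sq₀ dist_nonneg hr.le).1 ?_⟩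
  rw [dist_sq_eq]
  have e : (w 0 - (c 0 + r * (z k).1)) ^ 2 + (w 1 - (c 1 + r * (z k).2)) ^ 2 =
      r ^ 2 * (((w 0 - c 0) / r - (z k).1) ^ 2 + ((w 1 - c 1) / r - (z k).2) ^ 2) := by
    field_simp
    ring
  calc _ = _ := e
    _ ≤ r ^ 2 * 1 := by gcongr
    _ = r ^ 2 := mul_one _

theorem encard_edges_le (hP : NoThreeCollinear P) (l : Link P) :
    {e : HullEdge P | l.radius ≤ e.radius ∧ (e.disk ∩ l.disk).Nonempty}.encard ≤ (28 : ℕ∞) := by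
  set c := midpoint ℝ l.fst l.snd
  obtain ⟨z, hz⟩ := exists_cover c l.radius_pos
  refine le_trans (Set.encard_le_encard
    (t := ⋃ k ∈ (Set.univ : Set (Fin 7)), {e : HullEdge P | z k ∈ e.disk}) ?_)
    (encard_biUnion_le_mul (n := 7) (k := 4) (by simp) fun k _ => encard_disk_le_four hP (z k))
  rintro e ⟨hr, y, hy, hy'⟩
  simp only [Set.mem_univ, Set.iUnion_true, Set.mem_iUnion, Set.mem_ofPred_eq]
  set m := midpoint ℝ e.src e.tgt with hm
  have hy1 : dist y m ≤ e.radius := hy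
  have hy2 : dist y c ≤ l.radius := hy'
  have hd : dist c m ≤ e.radius + l.radius := by
    linarith [dist_triangle_left c m y]
  -- a disk of the radius of the link, inside the edge-disk and still close to the link-disk
  obtain ⟨w, hw1, hw2⟩ : ∃ w, dist w c ≤ 2 * l.radius ∧ dist w m ≤ e.radius - l.radius := by
    rcases le_or_gt (dist c m) (2 * l.radius) with h | h
    · exact ⟨m, by rwa [dist_comm], by rw [dist_self]; linarith⟩
    · have hrp := l.radius_pos
      have hcm : 0 < dist c m := by linarith
      have ht : 2 * l.radius / dist c m ≤ 1 := (div_le_one hcm).2 h.le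
      refine ⟨AffineMap.lineMap c m (2 * l.radius / dist c m), ?_, ?_⟩
      · rw [dist_lineMap_left, Real.norm_of_nonneg (by positivity), div_mul_cancel₀ _ hcm.ne']
      · rw [dist_lineMap_right, Real.norm_of_nonneg (by linarith), sub_mul, one_mul,
          div_mul_cancel₀ _ hcm.ne']
        linarith
  obtain ⟨k, hk⟩ := hz w hw1
  refine ⟨k, ?_⟩
  change dist (z k) m ≤ e.radius
  linarith [dist_triangle_left (z k) m w]

/-- At most five links of one subchain that are at least as long as `l` meet the disk of `l`. -/
theorem encard_links_of_edge_le (l : Link P) (e : HullEdge P) :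
    {m : Link P | m.edge = e ∧ l.radius ≤ m.radius ∧ (m.carrier ∩ l.disk).Nonempty}.encard
      ≤ (5 : ℕ∞) := by
  by_contra hcon
  push Not at hcon
  have h6 : (6 : ℕ∞) ≤ _ := Order.add_one_le_of_lt hcon
  obtain ⟨t, hts, ht⟩ := Set.exists_subset_encard_eq h6
  have htf : t.Finite := Set.finite_of_encard_eq_coe (k := 6) ht
  lift t to Finset (Link P) using htf
  have htc : t.card = 6 := by
    rw [Set.encard_coe_eq_coe_finsetCard] at ht
    exact_mod_cast ht
  have hinj : Set.InjOn (fun m : Link P => proj e m.fst) t := by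
    intro m hm m' hm' h
    obtain ⟨h1, -⟩ := hts hm
    obtain ⟨h1', -⟩ := hts hm'
    exact Link.ext_of_edge_of_fst (h1.trans h1'.symm) (eq_of_mem_of_proj_eq m.fst_mem
      (h1 ▸ m.fst_mem_subchain) m'.fst_mem (h1' ▸ m'.fst_mem_subchain) h)
  have hcard : (t.image fun m : Link P => proj e m.fst).card = 6 := by
    rw [Finset.card_image_of_injOn hinj, htc]
  set g := (t.image fun m : Link P => proj e m.fst).orderEmbOfFin hcard
  have hg : ∀ i, ∃ m ∈ t, proj e m.fst = g i := fun i =>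
    Finset.mem_image.1 (Finset.orderEmbOfFin_mem _ hcard i)
  choose m hmt hmg using hg
  have hedge : ∀ i, (m i).edge = e := fun i => (hts (hmt i)).1
  have hrad : ∀ i, l.radius ≤ (m i).radius := fun i => (hts (hmt i)).2.1
  have hne : ∀ i, ∃ a, a ∈ (m i).carrier ∧ a ∈ l.disk := fun i => (hts (hmt i)).2.2
  choose a ha had using hne
  have hr := l.radius_pos
  have hL := e.lenSq_pos
  -- coordinates along and across `e` in which `l.disk` is a unit disk
  obtain ⟨κ, hκ0, hκ⟩ : ∃ κ : ℝ, 0 < κ ∧ κ ^ 2 * (e.lenSq * l.radius ^ 2) = 1 := by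
    refine ⟨(√(e.lenSq * l.radius ^ 2))⁻¹, by positivity, ?_⟩
    rw [inv_pow, Real.sq_sqrt (by positivity)]
    exact inv_mul_cancel₀ (by positivity)
  have hdist : ∀ p q : Plane, (κ * proj e p - κ * proj e q) ^ 2 +
      (κ * height e p - κ * height e q) ^ 2 = κ ^ 2 * (e.lenSq * dist p q ^ 2) := by
    intro p q
    have := lenSq_mul_dot e p q p q
    rw [dist_sq_eq, pow_two (p 0 - q 0), pow_two (p 1 - q 1), this]
    ring
  have hlt : ∀ i, proj e (m i).fst < proj e (m i).snd := by
    intro i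
    have := (m i).lt
    rwa [hedge i] at this
  refine SixLinks.false (α := Plane) (x := fun p => κ * proj e p) (y := fun p => κ * height e p)
    (S := subchain P e) (B := {p | p ∈ P ∧ p ∈ subchain P e}) (p := fun i => (m i).fst)
    (q := fun i => (m i).snd) (a := a) (cx := κ * proj e (midpoint ℝ l.fst l.snd))
    (cy := κ * height e (midpoint ℝ l.fst l.snd)) ?_
  refine ⟨fun _ h => h.2, fun i => ⟨(m i).fst_mem, ?_⟩, fun i => ⟨(m i).snd_mem, ?_⟩, fun i => ?_,
    fun i => ?_, fun i j hij => ?_, fun i => ?_, fun i => ?_, fun i => ?_, fun i => ?_, ?_,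
    fun i => ?_⟩
  · have := (m i).fst_mem_subchain
    rwa [hedge i] at this
  · have := (m i).snd_mem_subchain
    rwa [hedge i] at this
  · have := (ha i).1
    rwa [hedge i] at this
  · exact mul_lt_mul_of_pos_left (hlt i) hκ0
  · refine mul_le_mul_of_nonneg_left ?_ hκ0.le
    by_contra hc
    push Not at hc
    have h1 := (m i).consecutive _ (m j).fst_mem
    rw [hedge i] at h1
    refine h1 ?_ ⟨?_, hc⟩
    · have := (m j).fst_mem_subchain
      rwa [hedge j] at this
    · rw [hmg, hmg]
      exact g.strictMono hij
  · have := (ha i).2.1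
    rw [hedge i] at this
    exact mul_le_mul_of_nonneg_left this hκ0.le
  · have := (ha i).2.2
    rw [hedge i] at this
    exact mul_le_mul_of_nonneg_left this hκ0.le
  · rw [hdist]
    have h1 : 2 * l.radius ≤ dist (m i).snd (m i).fst := by
      have := hrad i
      rw [dist_comm]
      unfold Link.radius at *
      linarith
    calc (4 : ℝ) = κ ^ 2 * (e.lenSq * (2 * l.radius) ^ 2) := by linear_combination (-4) * hκ
      _ ≤ _ := by gcongr
  · have := (m i).mul_le_mul_of_mem_carrier (ha i)
    rw [hedge i] at this
    have := mul_le_mul_of_nonneg_left this (sq_nonneg κ)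
    linarith
  · intro z hz b hb z' hz' h1 h2 h3
    have := star_of_mem_subchain hz hb.1 hb.2 hz' (le_of_mul_le_mul_left h1 hκ0)
      (le_of_mul_le_mul_left h2 hκ0) (h3.imp (fun h => le_of_mul_le_mul_left h hκ0)
        fun h => le_of_mul_le_mul_left h hκ0)
    have := mul_le_mul_of_nonneg_left this (sq_nonneg κ)
    linarith
  · rw [hdist, ← hκ]
    have : dist (a i) (midpoint ℝ l.fst l.snd) ≤ l.radius := had i
    gcongr

theorem encard_intersecting_links_le (hP : NoThreeCollinear P) (l : Link P) :
    {m : Link P | m ≠ l ∧ l.radius ≤ m.radius ∧ (m.carrier ∩ l.carrier).Nonempty}.encard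
      ≤ (140 : ℕ∞) := by
  refine le_trans (Set.encard_le_encard ?_)
    (encard_biUnion_le_mul (n := 28) (k := 5) (encard_edges_le hP l)
      fun e _ => encard_links_of_edge_le l e)
  rintro m ⟨-, hr, a, ha, ha'⟩
  simp only [Set.mem_iUnion]
  exact ⟨m.edge, ⟨hr.trans m.radius_le_edge_radius, a, m.carrier_subset_edge_disk ha,
    l.carrier_subset_disk ha'⟩, rfl, hr, a, ha, l.carrier_subset_disk ha'⟩

/-- There are at most four links with a given first point, as it lies in the disk of their edges. -/
lemma encard_links_le (hP : NoThreeCollinear P) :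
    (Set.univ : Set (Link P)).encard ≤ (P.card * 4 : ℕ) := by
  refine le_trans (Set.encard_le_encard ?_) (encard_biUnion_le_mul (I := (P : Set Plane))
    (f := fun p => {l : Link P | l.fst = p}) (Set.encard_coe_eq_coe_finsetCard P).le fun p _ => ?_)
  · intro l _
    simp only [Set.mem_iUnion]
    exact ⟨l.fst, l.fst_mem, rfl⟩
  · refine le_trans (Set.encard_le_encard_of_injOn (f := Link.edge) ?_ ?_)
      (encard_disk_le_four hP p)
    · rintro l rfl
      exact subchain_subset_disk l.fst_mem_subchain
    · rintro l hl m hm h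
      exact Link.ext_of_edge_of_fst h (hl.trans hm.symm)

theorem encard_intersectingPairs_le (hP : NoThreeCollinear P) :
    (intersectingPairs P).encard ≤ ((560 * P.card : ℕ) : ℕ∞) := by
  have h : (intersectingPairs P).encard ≤ (P.card * 4 * 140 : ℕ) := by
    refine le_trans (Set.encard_le_encard ?_) (encard_biUnion_le_mul
      (f := fun l : Link P => (fun m => s(l, m)) '' {m : Link P | m ≠ l ∧ l.radius ≤ m.radius ∧
        (m.carrier ∩ l.carrier).Nonempty}) (encard_links_le hP) fun l _ =>
      (Set.encard_image_le _ _).trans (encard_intersecting_links_le hP l))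
    rintro _ ⟨l, m, hne, hlm, rfl⟩
    simp only [Set.mem_iUnion, Set.mem_univ, exists_true_left]
    -- each pair is counted at its link of smaller radius
    rcases le_total l.radius m.radius with hr | hr
    · exact ⟨l, m, ⟨hne.symm, hr, Set.inter_comm _ _ ▸ hlm⟩, rfl⟩
    · exact ⟨m, l, ⟨hne, hr, hlm⟩, Sym2.eq_swap⟩
  rwa [show P.card * 4 * 140 = 560 * P.card by ring] at h

end ArcChain

theorem mainTheorem5 :
    (∃ C : ℕ, ∀ P : Finset ArcChain.Plane, ArcChain.NoThreeCollinear P →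
      (ArcChain.intersectingPairs P).encard ≤ ((C * P.card : ℕ) : ℕ∞)) ∧
    (∀ P : Finset ArcChain.Plane, ArcChain.NoThreeCollinear P → ∀ l : ArcChain.Link P,
      {e : ArcChain.HullEdge P | l.radius ≤ e.radius ∧ (e.disk ∩ l.disk).Nonempty}.encard
        ≤ (28 : ℕ∞) ∧
      (∀ e : ArcChain.HullEdge P, (e.disk ∩ l.disk).Nonempty →
        {m : ArcChain.Link P | m.edge = e ∧ l.radius ≤ m.radius ∧
          (m.carrier ∩ l.disk).Nonempty}.encard ≤ (5 : ℕ∞)) ∧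
      {m : ArcChain.Link P | m ≠ l ∧ l.radius ≤ m.radius ∧
        (m.carrier ∩ l.carrier).Nonempty}.encard ≤ (140 : ℕ∞)) :=
  ⟨⟨560, fun _ hP => ArcChain.encard_intersectingPairs_le hP⟩, fun _ hP l =>
    ⟨ArcChain.encard_edges_le hP l, fun e _ => ArcChain.encard_links_of_edge_le l e,
      ArcChain.encard_intersecting_links_le hP l⟩⟩
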